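/- **Simulation theorem.** Conventions. *Formulas and Frege.* Propositional formulas are built from variables with the connectives $\neg$ and $\bigvee$ (unbounded fan-in; the inputs of a $\bigvee$-gate form a finite set); $A\vee B=\bigvee\{A,B\}$, $A\to B$ is $\neg A\vee B$, $\bigwedge_i A_i$ is $\neg\bigvee_i\neg A_i$, and FALSE is $\bigvee\emptyset$. The size of a formula is the number of symbols (variables and connectives) in it, an input of a $\bigvee$-gate being counted once; its depth is the largest number of gates on a root-to-leaf path. Frege is the system with axioms $A\vee\neg A$ and rules weakening $\frac{A}{A\vee B}$, cut $\frac{A\vee B\quad \neg A\vee C}{B\vee C}$, merging $\frac{\bigvee X\vee\bigvee Y}{\bigvee(X\cup Y)}$ and unmerging $\frac{\bigvee(X\cup Y)}{\bigvee X\vee\bigvee Y}$, where in the last two rules a disjunction $\bigvee\{A\}$ may also be written $A$. A derivation from a set of hypotheses is a sequence of formulas, each of which is a hypothesis, an axiom, or follows from earlier ones by a rule. Its size is the total number of symbols in it, and it has depth at most $d$ if all its formulas have. A refutation of $\Gamma$ is a derivation from $\Gamma$ whose last formula is FALSE. *Counting axioms.* For a finite set $V$ let $[V]^m$ be the set of $m$-element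 subsets of $V$, and write $e\perp f$ if $e\ne f$ and $e\cap f\neq\emptyset$. Frege with counting axioms modulo $m$ may also use as axioms all substitution instances, for $N\not\equiv 0 \pmod m$ and $V=\{1,\dots,N\}$, of $$\mathrm{Count}^V_m=\bigvee_{v\in V}\Big(\bigwedge_{e\in[V]^m,\,e\ni v}\neg x_e\Big)\vee\bigvee_{e,f\in[V]^m,\,e\perp f}(x_e\wedge x_f).$$ *Nullstellensatz.* A Nullstellensatz refutation of $F=(f_1,\dots,f_k)$, $f_i\in\mathbb{Z}_m[x_1,\dots,x_n]$, is a list of polynomials $p_1,\dots,p_k,r_1,\dots,r_n$ over $\mathbb{Z}_m$ with $\sum_i p_if_i+\sum_j r_j(x_j^2-x_j)=1$. Its size is the total number of monomials appearing in $p_1,\dots,p_k$ and $f_1,\dots,f_k$ (counted in each polynomial separately). *Reductions.* Let $x_I=\prod_{i\in I}x_i$, and let $\bar f$ be the multilinearization of $f$ (each monomial $\prod_{i\in I} x_i^{\alpha_i}$ with all $\alpha_i\geq 1$ is replaced by $x_I$). For a multilinear $f=\sum_I a_Ix_I$, with each $a_I$ read in $\{0,\dots,m-1\}$, let $M_f=\{(c,I):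 1\le c\le a_I\}$. Formulas $\theta_E$ ($E\in[M_f]^m$) form an $m$-partition of the satisfied monomials of $f$ if the following formula holds: $$\bigwedge_{E\in[M_f]^m}\Big(\theta_E\to\bigwedge_{(c,I)\in E}\bigwedge_{k\in I}x_k\Big)\wedge\bigwedge_{E,F\in[M_f]^m,\,E\perp F}(\neg\theta_E\vee\neg\theta_F)\wedge\bigwedge_{(c,I)\in M_f}\Big(\bigwedge_{k\in I}x_k\to\bigvee_{E\in[M_f]^m,\,E\ni(c,I)}\theta_E\Big).$$ A formula $\Gamma(x_1,\dots,x_n)$ reduces to $F$ in depth $d$ and size $T$ if there are formulas $\beta^i_E(x_1,\dots,x_n)$ ($1\le i\le k$, $E\in[M_{\bar f_i}]^m$) and a Frege derivation from $\Gamma$ (without counting axioms) of depth at most $d$ and size at most $T$ in which, for every $i$, the formula saying that the $\beta^i_E$ form an $m$-partition of the satisfied monomials of $\bar f_i$ is derived. **Theorem.** For every integer $m>1$ there is a constant $C$, depending only on $m$, such that the following holds. Let $\Gamma(x_1,\dots,x_n)$ be a propositional formula and $F$ a finite system of polynomials over $\mathbb{Z}_m$ in $x_1,\dots,x_n$ such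 that $\Gamma$ reduces to $F$ in depth $d$ and size $T$. If $F$ has a Nullstellensatz refutation of size $S$, then $\Gamma$ has a refutation in Frege with counting axioms modulo $m$ of depth at most $C\,d$ and size at most $C\,S^{2m}\,T$. -/

import Mathlib

/-! ### Propositional formulas over NOT and unbounded fan-in OR -/

/-- Propositional formulas with variables from `V`. The list `l` in `or l` lists the set of inputs
of an unbounded fan-in OR gate: `or l` is the disjunction of the set of the members of `l`. -/
inductive PForm (V : Type) : Type where
  | var : V → PForm V
  | neg : PForm V → PForm V
  | or : List (PForm V) → PForm V

namespace PForm

variable {V : Type}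

/-- The constant FALSE: the disjunction of the empty set. -/
def fls : PForm V := or []

/-- `A → B`, that is `¬A ∨ B`. -/
def imp (A B : PForm V) : PForm V := or [neg A, B]

/-- The conjunction of the members of a list, written with the connectives `¬` and `⋁`. -/
def conj (l : List (PForm V)) : PForm V := neg (or (l.map neg))

/-- `⋁_{a ∈ s} φ a`. -/
noncomputable def bigOr {α : Type} (s : Finset α) (φ : α → PForm V) : PForm V :=
  or (s.toList.map φ)

/-- `⋀_{a ∈ s} φ a`. -/
noncomputable def bigAnd {α : Type} (s : Finset α) (φ : α → PForm V) : PForm V :=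
  conj (s.toList.map φ)

mutual
/-- The number of symbols (occurrences of variables and connectives) of a formula. The inputs of an
OR gate form a set, so an input that is listed repeatedly is counted once. -/
noncomputable def size : PForm V → ℕ
  | var _ => 1
  | neg A => 1 + size A
  | or l => 1 + sizeList l
/-- The total size of the distinct members of a list. -/
noncomputable def sizeList : List (PForm V) → ℕ
  | [] => 0
  | A :: l => (open Classical in if A ∈ l then 0 else size A) + sizeList l
end

mutual
/-- The depth of a formula: the largest number of gates on a path from the root to a leaf. -/
def depth : PForm V → ℕ
  | var _ => 0
  | neg A => 1 + depth A
  | or l => 1 + depthList l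
/-- The largest depth of a member of a list. -/
def depthList : List (PForm V) → ℕ
  | [] => 0
  | A :: l => max (depth A) (depthList l)
end

/-- `P` is the disjunction `⋁ X` of the set of members of `X`; as usual, the disjunction of a
one-element set `{P}` may be written as `P` itself. -/
def IsDisj (X : List (PForm V)) (P : PForm V) : Prop := P = or X ∨ X = [P]

end PForm

/-! ### Frege derivations -/

/-- `FregeRule Δ A`: the formula `A` follows from the premises `Δ` by an axiom schema
(no premises) or an inference rule of the Frege system. -/
inductive FregeRule {V : Type} : List (PForm V) → PForm V → Prop where
  | excludedMiddle (A : PForm V) : FregeRule [] (.or [A, .neg A])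
  | weakening (A B : PForm V) : FregeRule [A] (.or [A, B])
  | cut (A B C : PForm V) : FregeRule [.or [A, B], .or [.neg A, C]] (.or [B, C])
  | merging (X Y Z : List (PForm V)) (P Q R : PForm V)
      (hX : PForm.IsDisj X P) (hY : PForm.IsDisj Y Q) (hZ : PForm.IsDisj Z R)
      (hXYZ : ∀ A, A ∈ Z ↔ A ∈ X ∨ A ∈ Y) : FregeRule [.or [P, Q]] R
  | unmerging (X Y Z : List (PForm V)) (P Q R : PForm V)
      (hX : PForm.IsDisj X P) (hY : PForm.IsDisj Y Q) (hZ : PForm.IsDisj Z R)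
      (hXYZ : ∀ A, A ∈ Z ↔ A ∈ X ∨ A ∈ Y) : FregeRule [R] (.or [P, Q])

/-- The sequence `L` is a Frege derivation from the set of hypotheses `H` that may also use the
members of `Ax` as additional axioms. -/
def IsDerivation {V : Type} (Ax H : Set (PForm V)) (L : List (PForm V)) : Prop :=
  ∀ (i : ℕ) (hi : i < L.length), L[i] ∈ H ∨ L[i] ∈ Ax ∨
    ∃ Δ : List (PForm V), FregeRule Δ L[i] ∧ ∀ A ∈ Δ, A ∈ L.take i

/-- The size of a derivation: the total number of symbols in it. -/
noncomputable def derivationSize {V : Type} (L : List (PForm V)) : ℕ := (L.map PForm.size).sum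

/-- A derivation has depth at most `d` if each of its formulas has. -/
def DerivationDepthLE {V : Type} (L : List (PForm V)) (d : ℕ) : Prop := ∀ A ∈ L, A.depth ≤ d

/-- A refutation is a derivation whose final formula is FALSE. -/
def IsRefutation {V : Type} (Ax H : Set (PForm V)) (L : List (PForm V)) : Prop :=
  IsDerivation Ax H L ∧ L.getLast? = some PForm.fls

/-! ### Counting axioms -/

/-- `e ⊥ f`: the sets `e` and `f` are distinct and meet. -/
def Conflict {α : Type} (e f : Finset α) : Prop := e ≠ f ∧ ¬ Disjoint e f

/-- The ordered pairs of conflicting `m`-element subsets of `s`. -/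
noncomputable def conflictPairs {α : Type} (m : ℕ) (s : Finset α) :
    Finset (Finset α × Finset α) :=
  open Classical in
  (s.powersetCard m ×ˢ s.powersetCard m).filter (fun q => Conflict q.1 q.2)

/-- The `m`-element subsets of `s` that contain `v`. -/
noncomputable def edgesAt {α : Type} (m : ℕ) (s : Finset α) (v : α) : Finset (Finset α) :=
  open Classical in (s.powersetCard m).filter (fun e => v ∈ e)

/-- The substitution instance `x_e ← φ e` of the counting formula `Count_m^V` on `V = [N]`. -/
noncomputable def countFormula {V : Type} (m N : ℕ) (φ : Finset (Fin N) → PForm V) : PForm V :=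
  .or [.bigOr (Finset.univ : Finset (Fin N))
        (fun v => .bigAnd (edgesAt m Finset.univ v) (fun e => .neg (φ e))),
      .bigOr (conflictPairs m (Finset.univ : Finset (Fin N)))
        (fun q => .conj [φ q.1, φ q.2])]

/-- The counting axioms modulo `m`: all substitution instances of `Count_m^{[N]}` for the `N` that
are not divisible by `m`. -/
def countingAxioms (V : Type) (m : ℕ) : Set (PForm V) :=
  {A | ∃ N : ℕ, ¬ m ∣ N ∧ ∃ φ : Finset (Fin N) → PForm V, A = countFormula m N φ}

/-! ### Polynomials and Nullstellensatz refutations -/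

/-- The exponent vector of the multilinear monomial `x_I = ∏_{i ∈ I} x_i`. -/
noncomputable def sqfreeExp {n : ℕ} (I : Finset (Fin n)) : Fin n →₀ ℕ :=
  ∑ i ∈ I, Finsupp.single i 1

/-- The multilinearization of a polynomial. -/
noncomputable def multilinearization {n m : ℕ} (f : MvPolynomial (Fin n) (ZMod m)) :
    MvPolynomial (Fin n) (ZMod m) :=
  ∑ t ∈ f.support, MvPolynomial.monomial (sqfreeExp t.support) (f.coeff t)

/-- `p, r` is a Nullstellensatz refutation of the system `f`. -/
def IsNullstellensatzRefutation {n m k : ℕ} (f p : Fin k → MvPolynomial (Fin n) (ZMod m))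
    (r : Fin n → MvPolynomial (Fin n) (ZMod m)) : Prop :=
  ∑ i, p i * f i + ∑ j, r j * (MvPolynomial.X j ^ 2 - MvPolynomial.X j) = 1

/-- The size of a Nullstellensatz refutation: the number of monomials appearing in
`p_1, …, p_k` and `f_1, …, f_k`. -/
def nullstellensatzSize {n m k : ℕ} (f p : Fin k → MvPolynomial (Fin n) (ZMod m)) : ℕ :=
  ∑ i, ((p i).support.card + (f i).support.card)

/-! ### Reducing formulas to systems of polynomials -/

/-- The set `M_f` of monomials of a multilinear polynomial `f = ∑_I a_I x_I` over `ℤ/m`: the pair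
`(c, I)` with `1 ≤ c ≤ a_I` is the `c`-th copy of `x_I`, the coefficient `a_I` being read as an
integer in `{0, …, m - 1}`. -/
noncomputable def monomialCopies {n m : ℕ} (f : MvPolynomial (Fin n) (ZMod m)) :
    Finset (ℕ × Finset (Fin n)) :=
  (Finset.Icc 1 m ×ˢ Finset.univ).filter (fun q => q.1 ≤ (f.coeff (sqfreeExp q.2)).val)

/-- The formula `⋀_{k ∈ I} x_k`: the monomial `x_I` is satisfied. -/
noncomputable def satisfied {n : ℕ} (I : Finset (Fin n)) : PForm (Fin n) := .bigAnd I .var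

/-- The formula saying that the `θ E`, `E ∈ [M_f]^m`, form an `m`-partition of the satisfied
monomials of `f`. -/
noncomputable def partitionFormula {n m : ℕ} (f : MvPolynomial (Fin n) (ZMod m))
    (θ : Finset (ℕ × Finset (Fin n)) → PForm (Fin n)) : PForm (Fin n) :=
  .conj
    [.bigAnd ((monomialCopies f).powersetCard m)
        (fun E => .imp (θ E) (.bigAnd E (fun q => satisfied q.2))),
      .bigAnd (conflictPairs m (monomialCopies f))
        (fun q => .or [.neg (θ q.1), .neg (θ q.2)]),
      .bigAnd (monomialCopies f)
        (fun q => .imp (satisfied q.2) (.bigOr (edgesAt m (monomialCopies f) q) θ))]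

/-- `Γ` reduces to the system `f` in depth `d` and size `T`: there are formulas `β i E` and a Frege
derivation from `Γ`, of depth at most `d` and size at most `T`, in which for each `i` it is derived
that the `β i E` form an `m`-partition of the satisfied monomials of the multilinearization of
`f i`. -/
def ReducesTo {n m k : ℕ} (Γ : PForm (Fin n)) (f : Fin k → MvPolynomial (Fin n) (ZMod m))
    (d T : ℕ) : Prop :=
  ∃ (β : Fin k → Finset (ℕ × Finset (Fin n)) → PForm (Fin n)) (L : List (PForm (Fin n))),
    IsDerivation ∅ {Γ} L ∧ DerivationDepthLE L d ∧ derivationSize L ≤ T ∧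
      ∀ i, partitionFormula (multilinearization (f i)) (β i) ∈ L

-- Expand the products `p i * f i` into single monomials, a coefficient `a` counting as `a` copies.
-- A point is a copy of a monomial `x_J` of some `p i` (a block) together with a copy of a monomial
-- `x_I` of the multilinearized `f i`; it stands for `x_{J ∪ I}`. Under any assignment the satisfied
-- points fall into `m`-sets, because in each block with `x_J` true the formulas `β` partition the
-- satisfied monomials of `f i`. So do the unsatisfied points: evaluating the identity at 0/1 points
-- shows that, for every `A`, the number of points with monomial inside `A` is 1 modulo `m`. By
-- induction the points with monomial exactly `A ≠ ∅` are divisible by `m` in number and split into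
-- groups of `m` that are true or false together (`card_points_below`, `card_fiber_eq_zero`,
-- `exists_groups`). Points with empty monomial are always satisfied. Hence all points would be
-- partitioned into `m`-sets, although their number is 1 modulo `m`: a counting axiom refutes this.
--
-- The size `S^(2m) T` needs more care. A point lies on up to order `S^(m-1)` possible parts, so
-- there are order `S^(2m)` conflicts of two parts at a point, and refuting a disjunction of `N`
-- formulas by `Proves.neg_or` costs order `N log N`. To avoid the logarithm, each point is replaced
-- by a chain that scans its parts `T_0, T_1, …` one by one. Level `t` has vertices `k < m`. If none
-- of `T_0, …, T_t` is used, the level is an edge by itself; otherwise its vertices `k > 0` are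
-- linked with vertex 0 of level `t + 1`, and vertex 0 is covered by the part `T_t` or by the
-- previous link. The single last vertex is covered by the last link if some part is used, and by a
-- group edge if not. A chain has 1 modulo `m` vertices, so the contradiction survives. Every vertex
-- now has at most 3 edges, there are `N = O(S^(m+1))` vertices, `N log N` is absorbed by `S^(2m)`
-- since `m ≥ 2`, and local facts of size order `S^(m-1) T` add up to `S^(2m) T`.
--
-- All other variables of the counting axiom are replaced by FALSE. As the inputs of a gate form a
-- set, only `O(N)` distinct disjuncts remain (`Proves.counting`).
--
-- Inside Frege, fixed schematic inferences have derivations linear in the substituted formulas, by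
-- completeness and closure under substitution (`Proves.taut`). Long disjunctions are handled by
-- merging and unmerging whole sets (`Proves.imp_of_subset`, `Proves.split`). Each inference raises
-- the depth by a constant only.

namespace PForm

-- Size, depth, truth and substitution

variable {V W : Type}

theorem induction_on {P : PForm V → Prop} (hvar : ∀ x, P (var x)) (hneg : ∀ A, P A → P (neg A))
    (hor : ∀ l : List (PForm V), (∀ A ∈ l, P A) → P (or l)) (A : PForm V) : P A :=
  PForm.rec (motive_1 := P) (motive_2 := fun l => ∀ A ∈ l, P A) hvar hneg hor
    (by simp) (fun A l hA hl B hB => by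
      rcases List.mem_cons.1 hB with rfl | h
      · exact hA
      · exact hl B h) A

open Classical in
theorem sizeList_eq_sum (l : List (PForm V)) : sizeList l = ∑ A ∈ l.toFinset, size A := by
  induction l with
  | nil => simp [sizeList]
  | cons A l ih =>
    rw [sizeList, ih, List.toFinset_cons]
    by_cases h : A ∈ l
    · rw [if_pos h, Finset.insert_eq_of_mem (by simpa using h), zero_add]
    · rw [if_neg h, Finset.sum_insert (by simpa using h)]

theorem sizeList_mono {X Y : List (PForm V)} (h : X ⊆ Y) : sizeList X ≤ sizeList Y := by
  classical
  rw [sizeList_eq_sum, sizeList_eq_sum]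
  exact Finset.sum_le_sum_of_subset fun A hA => by simpa using h (by simpa using hA)

theorem sizeList_append (X Y : List (PForm V)) : sizeList (X ++ Y) ≤ sizeList X + sizeList Y := by
  classical
  rw [sizeList_eq_sum, sizeList_eq_sum, sizeList_eq_sum, List.toFinset_append,
    ← Finset.sum_union_inter]
  exact Nat.le_add_right _ _

theorem sizeList_cons_le (A : PForm V) (l : List (PForm V)) :
    sizeList (A :: l) ≤ size A + sizeList l := by
  rw [sizeList]; split_ifs <;> omega

theorem sizeList_le_length_mul {l : List (PForm V)} {s : ℕ} (h : ∀ A ∈ l, size A ≤ s) :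
    sizeList l ≤ l.length * s := by
  induction l with
  | nil => simp [sizeList]
  | cons A l ih =>
    have h1 := sizeList_cons_le A l
    have h2 := ih fun B hB => h B (List.mem_cons_of_mem _ hB)
    have h3 := h A List.mem_cons_self
    rw [List.length_cons, add_mul]; omega

theorem size_le_sizeList {A : PForm V} {l : List (PForm V)} (h : A ∈ l) : size A ≤ sizeList l := by
  classical
  rw [sizeList_eq_sum]
  exact Finset.single_le_sum (f := size) (fun _ _ => Nat.zero_le _) (by simpa using h)

theorem size_pos (A : PForm V) : 0 < size A := by
  cases A <;> simp [size]

theorem depthList_le_iff {l : List (PForm V)} {n : ℕ} :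
    depthList l ≤ n ↔ ∀ A ∈ l, depth A ≤ n := by
  induction l with
  | nil => simp [depthList]
  | cons A l ih => simp [depthList, ih]

theorem depth_or_le {l : List (PForm V)} {n : ℕ} (h : ∀ A ∈ l, depth A ≤ n) :
    depth (or l) ≤ 1 + n := by
  rw [depth]; exact Nat.add_le_add_left (depthList_le_iff.2 h) 1

theorem depth_lt_of_mem {A : PForm V} {l : List (PForm V)} (h : A ∈ l) :
    1 + depth A ≤ depth (or l) := by
  rw [depth]; exact Nat.add_le_add_left (depthList_le_iff.1 le_rfl A h) 1

mutual
/-- The truth value of a formula. -/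
def eval (v : V → Prop) : PForm V → Prop
  | var x => v x
  | neg A => ¬ eval v A
  | or l => evalList v l
/-- Some member of the list is true. -/
def evalList (v : V → Prop) : List (PForm V) → Prop
  | [] => False
  | A :: l => eval v A ∨ evalList v l
end

theorem evalList_iff {v : V → Prop} {l : List (PForm V)} :
    evalList v l ↔ ∃ A ∈ l, eval v A := by
  induction l with
  | nil => simp [evalList]
  | cons A l ih => simp [evalList, ih]

mutual
/-- Simultaneous substitution of formulas for the variables. -/
def subst (σ : V → PForm W) : PForm V → PForm W
  | var x => σ x
  | neg A => neg (subst σ A)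
  | or l => or (substList σ l)
/-- Substitution in every member of a list. -/
def substList (σ : V → PForm W) : List (PForm V) → List (PForm W)
  | [] => []
  | A :: l => subst σ A :: substList σ l
end

theorem substList_eq_map (σ : V → PForm W) (l : List (PForm V)) :
    substList σ l = l.map (subst σ) := by
  induction l with
  | nil => rfl
  | cons A l ih => simp [substList, ih]

/-- Substitution may identify inputs of a gate, which only lowers the size. The factor is `s + 1`
and not `s` so that it is at least 1 and also pays for the connectives. -/
theorem size_subst_le {σ : V → PForm W} {s : ℕ} (hσ : ∀ x, size (σ x) ≤ s) (A : PForm V) :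
    size (subst σ A) ≤ size A * (s + 1) := by
  classical
  induction A using induction_on with
  | hvar x => have := hσ x; simp only [subst, size]; omega
  | hneg A ih => simp only [subst, size, add_mul]; omega
  | hor l ih =>
    have : sizeList (l.map (subst σ)) ≤ sizeList l * (s + 1) := by
      rw [sizeList_eq_sum, sizeList_eq_sum, Finset.sum_mul]
      have : (l.map (subst σ)).toFinset = l.toFinset.image (subst σ) := by ext; simp
      rw [this]
      refine (Finset.sum_image_le_of_nonneg fun _ _ => Nat.zero_le _).trans ?_
      exact Finset.sum_le_sum fun A hA => ih A (by simpa using hA)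
    simp only [subst, size, add_mul, substList_eq_map]; omega

theorem depth_subst_le {σ : V → PForm W} {δ : ℕ} (hσ : ∀ x, depth (σ x) ≤ δ) (A : PForm V) :
    depth (subst σ A) ≤ depth A + δ := by
  induction A using induction_on with
  | hvar x => simpa [subst, depth] using hσ x
  | hneg A ih => simp only [subst, depth]; omega
  | hor l ih =>
    have : depthList (l.map (subst σ)) ≤ depthList l + δ := by
      refine depthList_le_iff.2 fun B hB => ?_
      obtain ⟨A, hA, rfl⟩ := List.mem_map.1 hB
      exact (ih A hA).trans (Nat.add_le_add_right (depthList_le_iff.1 le_rfl A hA) δ)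
    simp only [subst, depth, substList_eq_map]; omega

theorem IsDisj.map {X : List (PForm V)} {P : PForm V} (h : IsDisj X P) (σ : V → PForm W) :
    IsDisj (X.map (subst σ)) (subst σ P) := by
  rcases h with rfl | rfl
  · left; simp [subst, substList_eq_map]
  · right; rfl

end PForm

open PForm

variable {V W : Type}

theorem FregeRule.map {Δ : List (PForm V)} {A : PForm V} (h : FregeRule Δ A) (σ : V → PForm W) :
    FregeRule (Δ.map (subst σ)) (subst σ A) := by
  have key : ∀ X Y Z : List (PForm V), (∀ A, A ∈ Z ↔ A ∈ X ∨ A ∈ Y) →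
      ∀ A, A ∈ Z.map (subst σ) ↔ A ∈ X.map (subst σ) ∨ A ∈ Y.map (subst σ) := by
    intro X Y Z h A
    simp only [List.mem_map, h]
    constructor
    · rintro ⟨B, hB | hB, rfl⟩
      exacts [.inl ⟨B, hB, rfl⟩, .inr ⟨B, hB, rfl⟩]
    · rintro (⟨B, hB, rfl⟩ | ⟨B, hB, rfl⟩)
      exacts [⟨B, .inl hB, rfl⟩, ⟨B, .inr hB, rfl⟩]
  cases h with
  | excludedMiddle A => exact .excludedMiddle _
  | weakening A B => exact .weakening _ _
  | cut A B C => exact .cut _ _ _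
  | merging X Y Z P Q R hX hY hZ hXYZ =>
    exact .merging _ _ _ _ _ _ (hX.map σ) (hY.map σ) (hZ.map σ) (key _ _ _ hXYZ)
  | unmerging X Y Z P Q R hX hY hZ hXYZ =>
    exact .unmerging _ _ _ _ _ _ (hX.map σ) (hY.map σ) (hZ.map σ) (key _ _ _ hXYZ)

/-! ### Derivability and completeness -/

/-- Derivability of a formula from a set of hypotheses. -/
inductive Derivable (K : Set (PForm V)) : PForm V → Prop where
  | hyp {A : PForm V} : A ∈ K → Derivable K A
  | rule {Δ : List (PForm V)} {A : PForm V} :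
      FregeRule Δ A → (∀ B ∈ Δ, Derivable K B) → Derivable K A

namespace Derivable

variable {K : Set (PForm V)} {A B : PForm V} {Γ Δ X Y Z : List (PForm V)}

theorem em (A : PForm V) : Derivable K (or [A, neg A]) :=
  .rule (.excludedMiddle A) (by simp)

theorem weaken (h : Derivable K A) (B : PForm V) : Derivable K (or [A, B]) :=
  .rule (.weakening A B) (by simpa using h)

theorem merge {P Q R : PForm V} (h : Derivable K (or [P, Q])) (hX : IsDisj X P) (hY : IsDisj Y Q)
    (hZ : IsDisj Z R) (hXYZ : ∀ A, A ∈ Z ↔ A ∈ X ∨ A ∈ Y) : Derivable K R :=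
  .rule (.merging X Y Z P Q R hX hY hZ hXYZ) (by simpa using h)

theorem unmerge {P Q R : PForm V} (h : Derivable K R) (hX : IsDisj X P) (hY : IsDisj Y Q)
    (hZ : IsDisj Z R) (hXYZ : ∀ A, A ∈ Z ↔ A ∈ X ∨ A ∈ Y) : Derivable K (or [P, Q]) :=
  .rule (.unmerging X Y Z P Q R hX hY hZ hXYZ) (by simpa using h)

/-- Weakening by the single formula `or Δ` and merging: since `Γ ⊆ Δ`, the union is `Δ` again. -/
theorem mono (h : Derivable K (or Γ)) (hΓ : Γ ⊆ Δ) : Derivable K (or Δ) :=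
  (h.weaken (or Δ)).merge (.inl rfl) (.inl rfl) (.inl rfl)
    fun _ => ⟨.inr, fun h => h.elim (fun h => hΓ h) id⟩

theorem fold (h : Derivable K (or (X ++ Γ))) : Derivable K (or (or X :: Γ)) :=
  (h.unmerge (X := X) (Y := Γ) (.inl rfl) (.inl rfl) (.inl rfl) (by simp)).merge
    (X := [or X]) (Y := Γ) (.inr rfl) (.inl rfl) (.inl rfl) (by simp)

theorem unfold (h : Derivable K (or (or X :: Γ))) : Derivable K (or (X ++ Γ)) :=
  (h.unmerge (X := [or X]) (Y := Γ) (.inr rfl) (.inl rfl) (.inl rfl) (by simp)).merge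
    (X := X) (Y := Γ) (.inl rfl) (.inl rfl) (.inl rfl) (by simp)

theorem singleton_iff : Derivable K (or [A]) ↔ Derivable K A :=
  ⟨fun h => (h.weaken (or [A])).merge (X := [A]) (Y := [A]) (Z := [A])
      (.inl rfl) (.inl rfl) (.inr rfl) (by simp),
    fun h => (h.weaken (or [A])).merge (X := [A]) (Y := [A]) (Z := [A])
      (.inr rfl) (.inl rfl) (.inl rfl) (by simp)⟩

theorem cut (h₁ : Derivable K (or (A :: Γ))) (h₂ : Derivable K (or (neg A :: Δ))) :
    Derivable K (or (Γ ++ Δ)) := by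
  have h₁ := h₁.unmerge (X := [A]) (Y := Γ) (.inr rfl) (.inl rfl) (.inl rfl) (by simp)
  have h₂ := h₂.unmerge (X := [neg A]) (Y := Δ) (.inr rfl) (.inl rfl) (.inl rfl) (by simp)
  have h₃ : Derivable K (or [or Γ, or Δ]) :=
    .rule (.cut A _ _) (by simpa using ⟨h₁, h₂⟩)
  exact h₃.merge (.inl rfl) (.inl rfl) (.inl rfl) (by simp)

theorem neg_neg (h : Derivable K (or (A :: Γ))) : Derivable K (or (neg (neg A) :: Γ)) :=
  (h.cut (em (neg A))).mono (by simp)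

theorem neg_or (h : ∀ A ∈ X, Derivable K (or (neg A :: Γ))) :
    Derivable K (or (neg (or X) :: Γ)) := by
  have key : ∀ Y : List (PForm V), Y ⊆ X → Derivable K (or (Y ++ neg (or X) :: Γ)) →
      Derivable K (or (neg (or X) :: Γ)) := by
    intro Y
    induction Y with
    | nil => exact fun _ h => h
    | cons A Y ih =>
      intro hY h'
      exact ih (fun B hB => hY (List.mem_cons_of_mem _ hB))
        ((h'.cut (h A (hY List.mem_cons_self))).mono (by simp))
  refine key X (fun _ h => h) ?_
  exact (em (or X)).unfold.mono (by simp)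

/-- A literal: a variable or a negated variable. -/
def IsLiteral (A : PForm V) : Prop := ∃ x, A = var x ∨ A = neg (var x)

/-- Backward proof search: `Γ` holds the formulas still to be decomposed, `Λ` the literals already
split off. Each decomposition preserves validity and lowers `sizeOf Γ`. -/
theorem of_valid_aux (n : ℕ) : ∀ Γ Λ : List (PForm V), sizeOf Γ ≤ n → (∀ A ∈ Λ, IsLiteral A) →
    (∀ v, ∃ A ∈ Γ ++ Λ, eval v A) → Derivable K (or (Γ ++ Λ)) := by
  induction n with
  | zero => intro Γ Λ h; cases Γ <;> simp at h
  | succ n ih =>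
    intro Γ Λ hn hΛ hv
    cases Γ with
    | nil =>
      by_cases hx : ∃ x, var x ∈ Λ ∧ neg (var x) ∈ Λ
      · obtain ⟨x, h1, h2⟩ := hx
        exact (em (var x)).mono (by simp [h1, h2])
      · push Not at hx
        -- Without a complementary pair, making `x` true exactly when `¬x` is listed falsifies every
        -- literal in `Λ`.
        obtain ⟨A, hA, hAv⟩ := hv fun x => neg (var x) ∈ Λ
        obtain ⟨x, rfl | rfl⟩ := hΛ A hA
        · exact absurd hAv (hx x hA)
        · exact absurd hA hAv
    | cons B Γ =>
      simp only [List.cons.sizeOf_spec] at hn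
      have lit : IsLiteral B → Derivable K (or (B :: Γ ++ Λ)) := fun hB =>
        (ih Γ (B :: Λ) (by omega) (by simpa using ⟨hB, hΛ⟩) fun v => by
          obtain ⟨A, hA, h⟩ := hv v
          exact ⟨A, by simp at hA ⊢; tauto, h⟩).mono (by intro A; simp; tauto)
      cases B with
      | var x => exact lit ⟨x, .inl rfl⟩
      | or l =>
        refine fold (Γ := Γ ++ Λ) ?_
        rw [← List.append_assoc]
        have hl : sizeOf (l ++ Γ) + 1 = sizeOf l + sizeOf Γ := by
          clear lit hv hn
          induction l with
          | nil => simp; omega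
          | cons A l ih => simp; omega
        refine ih _ _ (by simp at hn; omega) hΛ fun v => ?_
        obtain ⟨A, hA, h⟩ := hv v
        simp only [List.cons_append, List.mem_cons] at hA
        rcases hA with rfl | hA
        · rw [eval, evalList_iff] at h
          obtain ⟨A, hA, h⟩ := h
          exact ⟨A, by simp [hA], h⟩
        · exact ⟨A, by simp at hA ⊢; tauto, h⟩
      | neg B =>
        cases B with
        | var x => exact lit ⟨x, .inr rfl⟩
        | neg B =>
          refine neg_neg (Γ := Γ ++ Λ) (ih (B :: Γ) Λ (by simp at hn ⊢; omega) hΛ fun v => ?_)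
          obtain ⟨A, hA, h⟩ := hv v
          simp only [List.cons_append, List.mem_cons] at hA
          rcases hA with rfl | hA
          · exact ⟨B, by simp, by simpa [eval] using h⟩
          · exact ⟨A, by simp at hA ⊢; tauto, h⟩
        | or l =>
          refine neg_or (Γ := Γ ++ Λ) fun B hB => ?_
          have := List.sizeOf_lt_of_mem hB
          refine ih (neg B :: Γ) Λ (by simp at hn ⊢; omega) hΛ fun v => ?_
          obtain ⟨A, hA, h⟩ := hv v
          simp only [List.cons_append, List.mem_cons] at hA
          rcases hA with rfl | hA
          · exact ⟨neg B, by simp, fun hB' => h (by rw [eval, evalList_iff]; exact ⟨B, hB, hB'⟩)⟩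
          · exact ⟨A, by simp at hA ⊢; tauto, h⟩

/-- Completeness for finitely many hypotheses. -/
theorem of_entails {H : List (PForm V)} {A : PForm V}
    (h : ∀ v, (∀ B ∈ H, eval v B) → eval v A) : Derivable {B | B ∈ H} A := by
  -- The disjunction of `A` and the negated hypotheses is valid, hence derivable outright; the
  -- hypotheses are then cut away one by one.
  have h0 : Derivable {B | B ∈ H} (or (H.map neg ++ [A])) := by
    have := of_valid_aux (K := {B | B ∈ H}) _ (H.map neg ++ [A]) [] le_rfl (by simp) fun v => by
      by_cases hA : ∀ B ∈ H, eval v B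
      · exact ⟨A, by simp, h v hA⟩
      · push Not at hA
        obtain ⟨B, hB, hBv⟩ := hA
        exact ⟨neg B, by simp [hB], hBv⟩
    simpa using this
  have key : ∀ X : List (PForm V), X ⊆ H → Derivable {B | B ∈ H} (or (X.map neg ++ [A])) →
      Derivable {B | B ∈ H} (or [A]) := by
    intro X
    induction X with
    | nil => exact fun _ h => h
    | cons B X ih =>
      intro hX h'
      have hB : Derivable {B | B ∈ H} (or [B]) := singleton_iff.2 (.hyp (hX List.mem_cons_self))
      exact ih (fun C hC => hX (List.mem_cons_of_mem _ hC)) (hB.cut h')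
  exact singleton_iff.1 (key H (fun _ h => h) h0)

end Derivable

/-! ### Derivations with cost -/

/-- `L`, read from its end, is a derivation from the formulas in `K` and the axioms `Ax`, in which
the members of `K` need not be listed. -/
inductive Steps (Ax K : Set (PForm V)) : List (PForm V) → Prop where
  | nil : Steps Ax K []
  | ax {L : List (PForm V)} {A : PForm V} : Steps Ax K L → A ∈ Ax → Steps Ax K (A :: L)
  | rule {L Δ : List (PForm V)} {A : PForm V} : Steps Ax K L → FregeRule Δ A →
      (∀ B ∈ Δ, B ∈ K ∨ B ∈ L) → Steps Ax K (A :: L)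

namespace Steps

variable {Ax K K' : Set (PForm V)} {L L' : List (PForm V)}

theorem mono (h : Steps Ax K L) (hK : K ⊆ K') : Steps Ax K' L := by
  induction h with
  | nil => exact .nil
  | ax _ hA ih => exact .ax ih hA
  | rule _ hr hΔ ih => exact .rule ih hr fun B hB => (hΔ B hB).imp (fun h => hK h) id

theorem append (h : Steps Ax K L) (h' : Steps Ax (K ∪ {A | A ∈ L}) L') :
    Steps Ax K (L' ++ L) := by
  induction h' with
  | nil => exact h
  | ax _ hA ih => exact .ax ih hA
  | rule _ hr hΔ ih =>
    refine .rule ih hr fun B hB => ?_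
    have := hΔ B hB
    simp only [Set.mem_union, Set.mem_ofPred_eq] at this
    exact this.elim (fun h => h.imp id fun h => List.mem_append_right _ h)
      fun h => .inr (List.mem_append_left _ h)

theorem map {W : Type} {Ax' : Set (PForm W)} (h : Steps ∅ K L) (σ : V → PForm W) :
    Steps Ax' (subst σ '' K) (L.map (subst σ)) := by
  induction h with
  | nil => exact .nil
  | ax _ hA ih => exact hA.elim
  | rule _ hr hΔ ih =>
    refine .rule ih (hr.map σ) fun B hB => ?_
    obtain ⟨A, hA, rfl⟩ := List.mem_map.1 hB
    exact (hΔ A hA).imp (fun h => ⟨A, h, rfl⟩) (fun h => List.mem_map_of_mem h)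

theorem isDerivation_append {H : Set (PForm V)} {L₀ : List (PForm V)}
    (h : Steps Ax {A | A ∈ L₀} L) (h₀ : IsDerivation Ax H L₀) :
    IsDerivation Ax H (L₀ ++ L.reverse) := by
  induction h with
  | nil => simpa using h₀
  | @ax L A _ hA ih =>
    intro i hi
    rw [List.reverse_cons, ← List.append_assoc] at hi
    simp only [List.reverse_cons, ← List.append_assoc]
    by_cases h : i < (L₀ ++ L.reverse).length
    · rw [List.getElem_append_left h, List.take_append_of_le_length h.le]
      exact ih i h
    · have : i = (L₀ ++ L.reverse).length := by simp at hi h ⊢; omega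
      subst this
      right; left
      simpa using hA
  | @rule L Δ A _ hr hΔ ih =>
    intro i hi
    rw [List.reverse_cons, ← List.append_assoc] at hi
    simp only [List.reverse_cons, ← List.append_assoc]
    by_cases h : i < (L₀ ++ L.reverse).length
    · rw [List.getElem_append_left h, List.take_append_of_le_length h.le]
      exact ih i h
    · have : i = (L₀ ++ L.reverse).length := by simp at hi h ⊢; omega
      subst this
      right; right
      refine ⟨Δ, ?_, fun B hB => ?_⟩
      · rw [List.getElem_append_right le_rfl]; simpa using hr
      · rw [List.take_left]; simpa using hΔ B hB

end Steps

theorem Derivable.exists_steps {K : Set (PForm V)} {A : PForm V} (h : Derivable K A) :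
    ∃ L, Steps ∅ K L ∧ (A ∈ K ∨ A ∈ L) := by
  induction h with
  | hyp h => exact ⟨[], .nil, .inl h⟩
  | @rule Δ A hr _ ih =>
    have key : ∀ X : List (PForm V), X ⊆ Δ → ∃ L, Steps ∅ K L ∧ ∀ B ∈ X, B ∈ K ∨ B ∈ L := by
      intro X
      induction X with
      | nil => exact fun _ => ⟨[], .nil, by simp⟩
      | cons B X ihX =>
        intro hX
        obtain ⟨L₁, h₁, h₁'⟩ := ihX fun C hC => hX (List.mem_cons_of_mem _ hC)
        obtain ⟨L₂, h₂, h₂'⟩ := ih B (hX List.mem_cons_self)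
        refine ⟨L₂ ++ L₁, h₁.append (h₂.mono Set.subset_union_left), fun C hC => ?_⟩
        rw [List.mem_append]
        rcases List.mem_cons.1 hC with rfl | hC
        · tauto
        · have := h₁' C hC; tauto
    obtain ⟨L, hL, h⟩ := key Δ fun _ h => h
    exact ⟨A :: L, .rule hL hr h, .inr List.mem_cons_self⟩

/-- All members of `G` can be derived from `K` by steps of depth at most `D` and of total size at
most `n`. -/
def Proves (Ax : Set (PForm V)) (D : ℕ) (K : Set (PForm V)) (n : ℕ) (G : Set (PForm V)) : Prop :=
  ∃ L, Steps Ax K L ∧ DerivationDepthLE L D ∧ derivationSize L ≤ n ∧ ∀ A ∈ G, A ∈ K ∨ A ∈ L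

/-- The size is at most `s` and the depth is at most `δ`. -/
def PForm.Within (s δ : ℕ) (A : PForm V) : Prop := size A ≤ s ∧ depth A ≤ δ

-- Combining derivations with bounds on size and depth

namespace Proves

variable {Ax K K' G G' : Set (PForm V)} {D n n' s δ : ℕ} {A B C P Q R : PForm V}
  {X Y Z : List (PForm V)}

theorem mono (h : Proves Ax D K n G) (hn : n ≤ n') (hG : G' ⊆ G) : Proves Ax D K n' G' := by
  obtain ⟨L, h₁, h₂, h₃, h₄⟩ := h
  exact ⟨L, h₁, h₂, h₃.trans hn, fun A hA => h₄ A (hG hA)⟩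

theorem cost (h : Proves Ax D K n G) (hn : n ≤ n') : Proves Ax D K n' G := h.mono hn subset_rfl

theorem hyps (h : Proves Ax D K n G) (hK : K ⊆ K') : Proves Ax D K' n G := by
  obtain ⟨L, h₁, h₂, h₃, h₄⟩ := h
  exact ⟨L, h₁.mono hK, h₂, h₃, fun A hA => (h₄ A hA).imp (fun h => hK h) id⟩

theorem of_subset (h : G ⊆ K) : Proves Ax D K n G :=
  ⟨[], .nil, by simp [DerivationDepthLE], by simp [derivationSize], fun A hA => .inl (h hA)⟩

theorem of_mem (h : A ∈ K) : Proves Ax D K n {A} := of_subset (by simpa using h)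

theorem trans (h : Proves Ax D K n G) (h' : Proves Ax D (K ∪ G) n' G') :
    Proves Ax D K (n + n') (G ∪ G') := by
  obtain ⟨L, h₁, h₂, h₃, h₄⟩ := h
  obtain ⟨L', h₁', h₂', h₃', h₄'⟩ := h'
  have hsub : K ∪ G ⊆ K ∪ {A | A ∈ L} :=
    Set.union_subset Set.subset_union_left fun A hA => h₄ A hA
  refine ⟨L' ++ L, h₁.append (h₁'.mono hsub), ?_, ?_, fun A hA => ?_⟩
  · intro A hA
    rcases List.mem_append.1 hA with hA | hA
    exacts [h₂' A hA, h₂ A hA]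
  · rw [derivationSize] at *
    rw [List.map_append, List.sum_append]; omega
  · rw [List.mem_append]
    rcases hA with hA | hA
    · have := h₄ A hA; tauto
    · rcases h₄' A hA with h | h
      · have := hsub h; simp at this; tauto
      · tauto

theorem and (h : Proves Ax D K n G) (h' : Proves Ax D K n' G') :
    Proves Ax D K (n + n') (G ∪ G') := h.trans (h'.hyps Set.subset_union_left)

theorem bind (h : Proves Ax D K n G) (h' : Proves Ax D (K ∪ G) n' G') :
    Proves Ax D K (n + n') G' := (h.trans h').mono le_rfl Set.subset_union_right

theorem axm (hA : A ∈ Ax) (hs : size A ≤ n) (hD : depth A ≤ D) : Proves Ax D K n {A} :=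
  ⟨[A], .ax .nil hA, by simpa [DerivationDepthLE] using hD, by simpa [derivationSize] using hs,
    by simp⟩

theorem step {Δ : List (PForm V)} (hr : FregeRule Δ A) (hΔ : ∀ B ∈ Δ, B ∈ K) (hs : size A ≤ n)
    (hD : depth A ≤ D) : Proves Ax D K n {A} :=
  ⟨[A], .rule .nil hr fun B hB => .inl (hΔ B hB), by simpa [DerivationDepthLE] using hD,
    by simpa [derivationSize] using hs, by simp⟩

theorem em (hs : 2 + 2 * size A ≤ n) (hD : depth A + 2 ≤ D) :
    Proves Ax D K n {or [A, neg A]} := by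
  refine step (.excludedMiddle A) (by simp) ?_ ?_
  · have := sizeList_cons_le A [neg A]
    have := sizeList_cons_le (neg A) []
    simp only [size, sizeList] at *; omega
  · simp only [depth, depthList]; omega

theorem merge (h : Proves Ax D K n {or [P, Q]}) (hX : IsDisj X P) (hY : IsDisj Y Q)
    (hZ : IsDisj Z R) (hXYZ : ∀ A, A ∈ Z ↔ A ∈ X ∨ A ∈ Y) (hs : size R ≤ n')
    (hD : depth R ≤ D) : Proves Ax D K (n + n') {R} :=
  h.bind (step (.merging X Y Z P Q R hX hY hZ hXYZ) (by simp) hs hD)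

theorem unmerge (h : Proves Ax D K n {R}) (hX : IsDisj X P) (hY : IsDisj Y Q)
    (hZ : IsDisj Z R) (hXYZ : ∀ A, A ∈ Z ↔ A ∈ X ∨ A ∈ Y) (hs : size (or [P, Q]) ≤ n')
    (hD : depth (or [P, Q]) ≤ D) : Proves Ax D K (n + n') {or [P, Q]} :=
  h.bind (step (.unmerging X Y Z P Q R hX hY hZ hXYZ) (by simp) hs hD)

theorem weaken (h : Proves Ax D K n {A}) (B : PForm V) (hs : size (or [A, B]) ≤ n')
    (hD : depth (or [A, B]) ≤ D) : Proves Ax D K (n + n') {or [A, B]} :=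
  h.bind (step (.weakening A B) (by simp) hs hD)

theorem size_pair_le (A B : PForm V) : size (or [A, B]) ≤ 1 + size A + size B := by
  have := sizeList_cons_le A [B]
  have := sizeList_cons_le B []
  simp only [size, sizeList] at *; omega

/-- Constantly many lines whatever the number of disjuncts: excluded middle for `⋁X`, weakening by a
disjunction that already contains `Z`, and merging, all with `¬⋁X` kept as one more input that is
unmerged at the end. The cost is therefore linear in the formula. -/
theorem imp_of_subset (hXZ : X ⊆ Z) (hZ : Within s δ (or Z)) (hD : δ + 4 ≤ D) :
    Proves Ax D K (30 * (s + 1)) {or [neg (or X), or Z]} := by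
  obtain ⟨hs, hδ⟩ := hZ
  have hX := sizeList_mono hXZ
  have dX : depthList X ≤ depthList Z := depthList_le_iff.2 fun A hA =>
    depthList_le_iff.1 le_rfl A (hXZ hA)
  have a1 := sizeList_append X [neg (or X)]
  have a2 := sizeList_append Z [neg (or X)]
  have a3 : sizeList [neg (or X)] ≤ 2 + sizeList X := by simp [sizeList, size]; omega
  have d1 : depthList (X ++ [neg (or X)]) ≤ δ + 1 := depthList_le_iff.2 fun A hA => by
    rcases List.mem_append.1 hA with hA | hA
    · have := depthList_le_iff.1 le_rfl A (hXZ hA); simp only [depth] at *; omega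
    · simp only [List.mem_singleton] at hA; subst hA; simp only [depth] at *; omega
  have d2 : depthList (Z ++ [neg (or X)]) ≤ δ + 1 := depthList_le_iff.2 fun A hA => by
    rcases List.mem_append.1 hA with hA | hA
    · have := depthList_le_iff.1 le_rfl A hA; simp only [depth] at *; omega
    · simp only [List.mem_singleton] at hA; subst hA; simp only [depth] at *; omega
  have p1 := size_pair_le (or (X ++ [neg (or X)])) (or (Z ++ [neg (or X)]))
  have p2 := size_pair_le (neg (or X)) (or Z)
  simp only [size, depth] at *
  have h1 : Proves Ax D K (4 * (s + 1)) {or [or X, neg (or X)]} :=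
    em (by simp only [size]; omega) (by simp only [depth]; omega)
  have h2 := h1.merge (X := X) (Y := [neg (or X)]) (n' := 3 * (s + 1)) (.inl rfl) (.inr rfl)
    (.inl rfl) (Z := X ++ [neg (or X)]) (by simp) (by simp only [size]; omega)
    (by simp only [depth]; omega)
  have h3 := h2.weaken (or (Z ++ [neg (or X)])) (n' := 8 * (s + 1)) (by simp only [size]; omega)
    (by simp only [depth, depthList]; omega)
  have h4 := h3.merge (R := or (Z ++ [neg (or X)])) (n' := 5 * (s + 1)) (.inl rfl) (.inl rfl)
    (.inl rfl) (by intro A; have := @hXZ A; simp; tauto) (by simp only [size]; omega)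
    (by simp only [depth]; omega)
  have h5 := h4.unmerge (X := [neg (or X)]) (Y := Z) (n' := 4 * (s + 1)) (.inr rfl) (.inl rfl)
    (.inl rfl) (by intro A; simp; tauto) (by simp only [size]; omega)
    (by simp only [depth, depthList]; omega)
  exact h5.cost (by omega)

/-- As for inclusions, constantly many lines suffice. This detaches one input of a disjunction, or
halves it, at linear cost. The bracketing of the conclusion is the one that unmerging yields. -/
theorem split (hXYZ : ∀ A, A ∈ Z ↔ A ∈ X ∨ A ∈ Y) (hZ : Within s δ (or Z)) (hD : δ + 4 ≤ D) :
    Proves Ax D K (30 * (s + 1)) {or [or [neg (or Z), or X], or Y]} := by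
  obtain ⟨hs, hδ⟩ := hZ
  have hXZ : X ⊆ Z := fun A hA => (hXYZ A).2 (.inl hA)
  have hYZ : Y ⊆ Z := fun A hA => (hXYZ A).2 (.inr hA)
  have hX := sizeList_mono hXZ
  have hY := sizeList_mono hYZ
  have dX : depthList X ≤ depthList Z := depthList_le_iff.2 fun A hA =>
    depthList_le_iff.1 le_rfl A (hXZ hA)
  have dY : depthList Y ≤ depthList Z := depthList_le_iff.2 fun A hA =>
    depthList_le_iff.1 le_rfl A (hYZ hA)
  have a1 := sizeList_append Z [neg (or Z)]
  have a2 := sizeList_append Y [neg (or Z)]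
  have a3 : sizeList [neg (or Z)] ≤ 2 + sizeList Z := by simp [sizeList, size]; omega
  have a4 := sizeList_cons_le (or X) (Y ++ [neg (or Z)])
  have d1 : depthList (Z ++ [neg (or Z)]) ≤ δ + 1 := depthList_le_iff.2 fun A hA => by
    rcases List.mem_append.1 hA with hA | hA
    · have := depthList_le_iff.1 le_rfl A hA; simp only [depth] at *; omega
    · simp only [List.mem_singleton] at hA; subst hA; simp only [depth] at *; omega
  have d2 : depthList (Y ++ [neg (or Z)]) ≤ δ + 1 := depthList_le_iff.2 fun A hA => by
    rcases List.mem_append.1 hA with hA | hA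
    · have := depthList_le_iff.1 le_rfl A (hYZ hA); simp only [depth] at *; omega
    · simp only [List.mem_singleton] at hA; subst hA; simp only [depth] at *; omega
  have p1 := size_pair_le (or X) (or (Y ++ [neg (or Z)]))
  have p2 := size_pair_le (or [neg (or Z), or X]) (or Y)
  have p3 := size_pair_le (neg (or Z)) (or X)
  simp only [size, depth] at *
  have h1 : Proves Ax D K (4 * (s + 1)) {or [or Z, neg (or Z)]} :=
    em (by simp only [size]; omega) (by simp only [depth]; omega)
  have h2 := h1.merge (X := Z) (Y := [neg (or Z)]) (n' := 3 * (s + 1)) (.inl rfl) (.inr rfl)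
    (.inl rfl) (Z := Z ++ [neg (or Z)]) (by simp) (by simp only [size]; omega)
    (by simp only [depth]; omega)
  have h3 := h2.unmerge (X := X) (Y := Y ++ [neg (or Z)]) (n' := 6 * (s + 1)) (.inl rfl)
    (.inl rfl) (.inl rfl) (by intro A; have := hXYZ A; simp; tauto) (by simp only [size]; omega)
    (by simp only [depth, depthList]; omega)
  have h4 := h3.merge (X := [or X]) (Y := Y ++ [neg (or Z)]) (Z := or X :: (Y ++ [neg (or Z)]))
    (n' := 6 * (s + 1)) (.inr rfl) (.inl rfl)
    (.inl rfl) (by simp) (by simp only [size]; omega)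
    (by simp only [depth, depthList]; omega)
  have h5 := h4.unmerge (X := [neg (or Z), or X]) (Y := Y) (n' := 6 * (s + 1)) (.inl rfl)
    (.inl rfl) (.inl rfl) (by intro A; simp; tauto) (by simp only [size]; omega)
    (by simp only [depth, depthList]; omega)
  exact h5.cost (by omega)

end Proves

/-- Every valid schematic inference has a derivation whose size is linear in the sizes of the
substituted formulas. -/
theorem Proves.taut {k : ℕ} (H : List (PForm (Fin k))) (A : PForm (Fin k))
    (h : ∀ v, (∀ B ∈ H, eval v B) → eval v A) :
    ∃ c : ℕ, ∀ {V : Type} {Ax K : Set (PForm V)} {D s δ : ℕ} {ns : List ℕ} (σ : Fin k → PForm V),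
      δ + c ≤ D → (∀ i, Within s δ (σ i)) →
      List.Forall₂ (fun B n => Proves Ax D K (n * (s + 1)) {subst σ B}) H ns →
      Proves Ax D K ((ns.sum + c) * (s + 1)) {subst σ A} := by
  obtain ⟨L, hL, hA⟩ := (Derivable.of_entails h).exists_steps
  -- One derivation of the schema is fixed before anything is substituted. Its size bounds the cost
  -- factor, and the sum of the depths of its lines bounds the increase of depth; `c` serves both
  -- purposes.
  refine ⟨derivationSize L + (L.map depth).sum, fun {V Ax K D s δ ns} σ hD hσ hH => ?_⟩
  have h1 : ∀ (H : List (PForm (Fin k))) (ns : List ℕ),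
      List.Forall₂ (fun B n => Proves Ax D K (n * (s + 1)) {subst σ B}) H ns →
      Proves Ax D K (ns.sum * (s + 1)) (subst σ '' {B | B ∈ H}) := by
    intro H ns hH
    induction hH with
    | nil => exact .of_subset (by simp)
    | cons hB _ ih =>
      refine (hB.and ih).mono (by rw [List.sum_cons, add_mul]) ?_
      rintro _ ⟨C, hC, rfl⟩
      rcases List.mem_cons.1 hC with rfl | hC
      · left; rfl
      · right; exact ⟨C, hC, rfl⟩
  have h2 : Proves Ax D (subst σ '' {B | B ∈ H})
      ((derivationSize L + (L.map depth).sum) * (s + 1)) {subst σ A} := by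
    refine ⟨L.map (subst σ), hL.map σ, ?_, ?_, ?_⟩
    · intro B hB
      obtain ⟨C, hC, rfl⟩ := List.mem_map.1 hB
      have h3 := depth_subst_le (fun i => (hσ i).2) C
      have h4 := List.le_sum_of_mem (List.mem_map_of_mem (f := depth) hC)
      omega
    · have : ∀ L : List (PForm (Fin k)),
          derivationSize (L.map (subst σ)) ≤ derivationSize L * (s + 1) := by
        intro L
        induction L with
        | nil => simp [derivationSize]
        | cons B L ih =>
          have := size_subst_le (fun i => (hσ i).1) B
          simp only [derivationSize, List.map_cons, List.sum_cons, add_mul] at *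
          omega
      refine (this L).trans (Nat.mul_le_mul_right _ (Nat.le_add_right _ _))
    · rintro _ rfl
      exact hA.imp (fun h => ⟨A, h, rfl⟩) (fun h => List.mem_map_of_mem h)
  exact ((h1 H ns hH).bind (h2.hyps Set.subset_union_right)).cost (by ring_nf; rfl)

namespace PForm.Within

variable {s s' δ δ' : ℕ} {A B C E F : PForm V} {X Z : List (PForm V)}

theorem mono (h : Within s δ A) (hs : s ≤ s') (hδ : δ ≤ δ') : Within s' δ' A :=
  ⟨h.1.trans hs, h.2.trans hδ⟩

theorem of_mem (hA : A ∈ Z) (h : Within s δ (or Z)) : Within s δ A := by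
  have h1 := size_le_sizeList hA
  have h2 := depth_lt_of_mem hA
  have h3 := h.1
  rw [size] at h3
  exact ⟨by omega, by have := h.2; omega⟩

theorem of_neg (h : Within s δ (neg A)) : Within s δ A := by
  have h1 := h.1
  have h2 := h.2
  simp only [size, depth] at h1 h2
  exact ⟨by omega, by omega⟩

theorem of_subset (hX : X ⊆ Z) (h : Within s δ (or Z)) : Within s δ (or X) := by
  have h1 := sizeList_mono hX
  have h2 : depthList X ≤ depthList Z :=
    depthList_le_iff.2 fun A hA => depthList_le_iff.1 le_rfl A (hX hA)
  have h3 := h.1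
  have h4 := h.2
  simp only [size, depth] at h3 h4
  exact ⟨by simp only [size]; omega, by simp only [depth]; omega⟩

theorem neg (h : Within s δ A) : Within (s + 1) (δ + 1) (neg A) := by
  have h1 := h.1
  have h2 := h.2
  exact ⟨by simp only [size]; omega, by simp only [depth]; omega⟩

theorem or_of_forall (h : ∀ A ∈ X, Within s δ A) : Within (1 + X.length * s) (δ + 1) (or X) :=
  ⟨by rw [size]; exact Nat.add_le_add_left (sizeList_le_length_mul fun A hA => (h A hA).1) 1,
    by rw [add_comm]; exact depth_or_le fun A hA => (h A hA).2⟩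

theorem forall₁ (hA : Within s δ A) : ∀ i, Within s δ (![A] i) := by
  intro i; fin_cases i; exact hA

theorem forall₂ (hA : Within s δ A) (hB : Within s δ B) : ∀ i, Within s δ (![A, B] i) := by
  intro i; fin_cases i; exacts [hA, hB]

theorem forall₃ (hA : Within s δ A) (hB : Within s δ B) (hC : Within s δ C) :
    ∀ i, Within s δ (![A, B, C] i) := by
  intro i; fin_cases i; exacts [hA, hB, hC]

theorem forall₄ (hA : Within s δ A) (hB : Within s δ B) (hC : Within s δ C) (hE : Within s δ E) :
    ∀ i, Within s δ (![A, B, C, E] i) := by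
  intro i; fin_cases i; exacts [hA, hB, hC, hE]

end PForm.Within

-- Unbounded disjunctions and conjunctions

namespace Proves

theorem imp_mem : ∃ c : ℕ, ∀ {V : Type} {Ax K : Set (PForm V)} {D s δ : ℕ} {A : PForm V}
    {Z : List (PForm V)}, A ∈ Z → Within s δ (or Z) → δ + c ≤ D →
    Proves Ax D K (c * (s + 1)) {or [neg A, or Z]} := by
  obtain ⟨c, hc⟩ := taut (k := 2) [or [neg (or [var 0]), var 1]] (or [neg (var 0), var 1])
    (by intro v; simp [eval, evalList])
  refine ⟨c + 40, fun {V Ax K D s δ A Z} hA hZ hD => ?_⟩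
  have h1 : Proves Ax D K (30 * (s + 1)) {or [neg (or [A]), or Z]} :=
    imp_of_subset (by simpa using hA) hZ (by omega)
  have := hc (δ := δ) ![A, or Z] (by omega) (.forall₂ (.of_mem hA hZ) hZ) (.cons h1 .nil)
  exact this.cost (Nat.mul_le_mul_right _ (by simp; omega))

/-- Inputs are split off one at a time, and each time the whole disjunction is written down again;
hence the product of the length and the full size `s`. -/
theorem or_elim : ∃ c : ℕ, ∀ {V : Type} {Ax K : Set (PForm V)} {D s δ n : ℕ} {C : PForm V}
    {l : List (PForm V)}, Within s δ (or l) → Within s δ C → δ + c ≤ D →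
    (∀ A ∈ l, Proves Ax D K (n * (s + 1)) {or [neg A, C]}) →
    Proves Ax D K ((l.length * (n + c) + c) * (s + 1)) {or [neg (or l), C]} := by
  obtain ⟨c₁, h₁⟩ := taut (k := 1) [] (or [neg (or []), var 0]) (by intro v; simp [eval, evalList])
  obtain ⟨c₂, h₂⟩ := taut (k := 4)
    [or [or [neg (var 0), or [var 1]], var 2], or [neg (var 1), var 3], or [neg (var 2), var 3]]
    (or [neg (var 0), var 3]) (by intro v; simp [eval, evalList]; tauto)
  refine ⟨c₁ + c₂ + 40, fun {V Ax K D s δ n C l} hl hC hD h => ?_⟩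
  induction l with
  | nil =>
    exact (h₁ (s := s) (δ := δ) ![C] (by omega) (.forall₁ hC) .nil).cost
      (Nat.mul_le_mul_right _ (by simp; omega))
  | cons A l ih =>
    have hl' : Within s δ (or l) := .of_subset (by simp) hl
    have ih := ih hl' fun B hB => h B (List.mem_cons_of_mem _ hB)
    have hs : Proves Ax D K (30 * (s + 1)) {or [or [neg (or (A :: l)), or [A]], or l]} :=
      split (by simp) hl (by omega)
    refine (h₂ (δ := δ) ![or (A :: l), A, or l, C] (by omega)
      (.forall₄ hl (.of_mem (by simp) hl) hl' hC)
      (.cons hs (.cons (h A (by simp)) (.cons ih .nil)))).cost (Nat.mul_le_mul_right _ ?_)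
    simp only [List.sum_cons, List.sum_nil, List.length_cons]
    ring_nf; omega

theorem conj_elim : ∃ c : ℕ, ∀ {V : Type} {Ax K : Set (PForm V)} {D s δ n : ℕ} {A : PForm V}
    {l : List (PForm V)}, A ∈ l → Within s δ (conj l) → δ + c ≤ D →
    Proves Ax D K (n * (s + 1)) {conj l} → Proves Ax D K ((n + c) * (s + 1)) {A} := by
  obtain ⟨c₁, h₁⟩ := imp_mem
  obtain ⟨c₂, h₂⟩ := taut (k := 2) [or [neg (neg (var 0)), var 1], neg (var 1)] (var 0)
    (by intro v; simp [eval, evalList]; tauto)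
  refine ⟨c₁ + c₂, fun {V Ax K D s δ n A l} hA hl hD h => ?_⟩
  have hl' : Within s δ (or (l.map neg)) := .of_neg hl
  have hA' : neg A ∈ l.map neg := List.mem_map_of_mem hA
  refine (h₂ (δ := δ) ![A, or (l.map neg)] (by omega)
    (.forall₂ (.of_neg (.of_mem hA' hl')) hl')
    (.cons (h₁ hA' hl' (by omega)) (.cons h .nil))).cost (Nat.mul_le_mul_right _ ?_)
  simp only [List.sum_cons, List.sum_nil]
  omega

/-- Refuting a disjunction of at most `2 ^ h` refutable formulas. -/
theorem neg_or : ∃ c : ℕ, ∀ {V : Type} {Ax K : Set (PForm V)} {D s δ n : ℕ}, δ + c ≤ D →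
    ∀ (h : ℕ) (l : List (PForm V)), l.length ≤ 2 ^ h → (∀ A ∈ l, Within s δ A) →
    (∀ A ∈ l, Proves Ax D K n {neg A}) →
    Proves Ax D K (l.length * n + c * (h + 1) * 2 ^ h * (s + 1)) {neg (or l)} := by
  obtain ⟨c₁, h₁⟩ := taut (k := 0) [] (neg (or [])) (by intro v; simp [eval, evalList])
  obtain ⟨c₂, h₂⟩ := taut (k := 1) [neg (var 0)] (neg (or [var 0]))
    (by intro v; simp [eval, evalList])
  obtain ⟨c₃, h₃⟩ := taut (k := 3)
    [or [or [neg (var 0), var 1], var 2], neg (var 1), neg (var 2)]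
    (neg (var 0)) (by intro v; simp [eval, evalList]; tauto)
  refine ⟨c₁ + c₂ + 2 * c₃ + 80, fun {V Ax K D s δ n} hD h => ?_⟩
  induction h with
  | zero =>
    intro l hl hW hn
    match l, hl, hW, hn with
    | [], _, _, _ =>
      refine (h₁ (s := s) (δ := δ) ![] (by omega) (fun i => i.elim0) .nil).cost ?_
      simp only [List.sum_nil, List.length_nil, zero_add, zero_mul, pow_zero, mul_one]
      gcongr; omega
    | [A], _, hW, hn =>
      refine ((hn A (by simp)).bind (h₂ (s := s) (δ := δ) (ns := [0]) ![A] (by omega)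
        (.forall₁ (hW A (by simp))) (.cons (of_mem (.inr rfl)) .nil))).cost ?_
      simp only [List.sum_cons, List.sum_nil, List.length_singleton, zero_add, one_mul, pow_zero,
        mul_one]
      gcongr; omega
  | succ h ih =>
    intro l hl hW hn
    -- Halving keeps the total size of the disjunctions on each level of the recursion at order `2 ^
    -- h * (s + 1)`, so that `h + 1` levels give an `N log N` bound. Splitting off one input at a
    -- time would be quadratic.
    have hlen : (l.take (2 ^ h)).length + (l.drop (2 ^ h)).length = l.length := by
      rw [← List.length_append, List.take_append_drop]
    have hWl : Within (1 + 2 ^ (h + 1) * s) (δ + 1) (or l) :=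
      (Within.or_of_forall hW).mono (by gcongr) le_rfl
    have i₁ := ih (l.take (2 ^ h)) (by simp) (fun A hA => hW A (List.mem_of_mem_take hA))
      fun A hA => hn A (List.mem_of_mem_take hA)
    have i₂ := ih (l.drop (2 ^ h)) (by rw [List.length_drop, pow_succ] at *; omega)
      (fun A hA => hW A (List.mem_of_mem_drop hA)) fun A hA => hn A (List.mem_of_mem_drop hA)
    have hs : ∀ K : Set (PForm V), Proves Ax D K (30 * (1 + 2 ^ (h + 1) * s + 1))
        {or [or [neg (or l), or (l.take (2 ^ h))], or (l.drop (2 ^ h))]} := fun K =>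
      split (fun A => by rw [← List.mem_append, List.take_append_drop]) hWl (by omega)
    refine ((i₁.and i₂).bind (h₃ (δ := δ + 1) (ns := [30, 0, 0])
      ![or l, or (l.take (2 ^ h)), or (l.drop (2 ^ h))] (by omega)
      (.forall₃ hWl (.of_subset (List.take_subset _ _) hWl)
        (.of_subset (List.drop_subset _ _) hWl))
      (.cons (hs _) (.cons (of_mem (.inr (.inl rfl))) (.cons (of_mem (.inr (.inr rfl)))
        .nil))))).cost ?_
    rw [← hlen]
    simp only [List.sum_cons, List.sum_nil, add_zero]
    have : (30 + c₃) * (1 + 2 ^ (h + 1) * s + 1) ≤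
        (c₁ + c₂ + 2 * c₃ + 80) * (2 ^ (h + 1) * (s + 1)) := by
      have h1 : 1 + 2 ^ (h + 1) * s + 1 ≤ 2 * (2 ^ (h + 1) * (s + 1)) := by
        have := Nat.one_le_two_pow (n := h + 1)
        nlinarith
      calc _ ≤ (30 + c₃) * (2 * (2 ^ (h + 1) * (s + 1))) := Nat.mul_le_mul_left _ h1
        _ = (60 + 2 * c₃) * (2 ^ (h + 1) * (s + 1)) := by ring
        _ ≤ _ := Nat.mul_le_mul_right _ (by omega)
    calc _ ≤ _ := Nat.add_le_add_left this _
      _ = _ := by rw [pow_succ]; ring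

end Proves

-- Contradictions from a counting axiom

theorem PForm.Within.neg_neg {s δ : ℕ} {A : PForm V} (h : Within s δ A) :
    Within (s + 2) (δ + 2) (.neg (.neg A)) := h.neg.neg

theorem PForm.Within.conj_pair {s δ : ℕ} {A B : PForm V} (hA : Within s δ A) (hB : Within s δ B) :
    Within (2 * s + 4) (δ + 3) (conj [A, B]) := by
  have := (Within.or_of_forall (X := [.neg A, .neg B]) (s := s + 1) (δ := δ + 1)
    (by simp [hA.neg, hB.neg])).neg
  exact this.mono (by simp; omega) (by omega)

theorem mem_edgesAt {α : Type} {m : ℕ} {S : Finset α} {v : α} {e : Finset α} :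
    e ∈ edgesAt m S v ↔ (e ⊆ S ∧ e.card = m) ∧ v ∈ e := by
  simp only [edgesAt, Finset.mem_filter, Finset.mem_powersetCard]

theorem mem_conflictPairs {α : Type} {m : ℕ} {S : Finset α} {q : Finset α × Finset α} :
    q ∈ conflictPairs m S ↔ (q.1 ⊆ S ∧ q.1.card = m) ∧ (q.2 ⊆ S ∧ q.2.card = m) ∧
      q.1 ≠ q.2 ∧ ¬ Disjoint q.1 q.2 := by
  simp only [conflictPairs, Finset.mem_filter, Finset.mem_product, Finset.mem_powersetCard,
    and_assoc]
  rfl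

theorem PForm.fls_within : Within 1 1 (fls : PForm V) :=
  ⟨by simp [fls, size, sizeList], by simp [fls, depth, depthList]⟩

set_option maxHeartbeats 1000000 in
open Classical in
/-- A contradiction from a perfect `m`-partition of a set whose size is not divisible by `m`, in
which at most `Δ` edges at each vertex may be present. -/
theorem Proves.counting (m Δ : ℕ) :
    ∃ c : ℕ, ∀ {V α : Type} {K : Set (PForm V)} {D s δ n h : ℕ} (S : Finset α)
      (φ : Finset α → PForm V) (inc : α → List (Finset α)), ¬ m ∣ S.card → 1 ≤ s → 1 ≤ δ →
      δ + c ≤ D → (∀ e, Within s δ (φ e)) → (∀ v, (inc v).length ≤ Δ) →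
      (∀ v ∈ S, ∀ e ∈ inc v, v ∈ e ∧ e ⊆ S ∧ e.card = m) →
      (∀ e ⊆ S, e.card = m → ∀ v ∈ e, e ∈ inc v ∨ φ e = fls) →
      (∀ v ∈ S, Proves (countingAxioms V m) D K (n * (s + 1)) {or ((inc v).map φ)}) →
      (∀ v ∈ S, ∀ e ∈ inc v, ∀ f ∈ inc v, e ≠ f →
        Proves (countingAxioms V m) D K (n * (s + 1)) {or [neg (φ e), neg (φ f)]}) →
      c * S.card ≤ 2 ^ h →
      Proves (countingAxioms V m) D K
        ((c * S.card * (n + c) + c * (h + 1) * 2 ^ h) * (s + 1)) {fls} := by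
  obtain ⟨c₁, imp_mem⟩ := imp_mem
  obtain ⟨c₂, or_elim⟩ := or_elim
  obtain ⟨c₃, neg_or⟩ := neg_or
  obtain ⟨c₄, h₄⟩ := taut (k := 2) [or [neg (neg (neg (var 0))), var 1]] (or [neg (var 0), var 1])
    (by intro v; simp [eval, evalList])
  obtain ⟨c₅, h₅⟩ := taut (k := 2) [or [neg (var 0), var 1], var 0] (neg (neg (var 1)))
    (by intro v; simp [eval, evalList]; tauto)
  obtain ⟨c₆, h₆⟩ := taut (k := 2) [or [neg (var 0), neg (var 1)]]
    (neg (conj [var 0, var 1])) (by intro v; simp [eval, evalList, conj]; tauto)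
  obtain ⟨c₇, h₇⟩ := taut (k := 1) [] (neg (conj [var 0, fls]))
    (by intro v; simp [eval, evalList, conj, fls])
  obtain ⟨c₈, h₈⟩ := taut (k := 1) [] (neg (conj [fls, var 0]))
    (by intro v; simp [eval, evalList, conj, fls])
  obtain ⟨c₉, h₉⟩ := taut (k := 3)
    [or [var 0, var 1], or [neg (var 0), var 2], or [neg (var 1), var 2], neg (var 2)] fls
    (by intro v; simp [eval, evalList, fls]; tauto)
  obtain ⟨d, hd⟩ : ∃ d, d = Δ * (c₁ + c₄ + c₂) + c₂ + c₄ + c₅ + c₆ + c₇ + c₈ + 1 := ⟨_, rfl⟩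
  obtain ⟨r, hr⟩ : ∃ r, r = 2 * Δ + 12 := ⟨_, rfl⟩
  obtain ⟨a, ha⟩ : ∃ a, a = (Δ + 1) * (Δ + 1) + 1 := ⟨_, rfl⟩
  refine ⟨(a + 1) * r * ((Δ + 1) * (d + 1)) + r * (2 * c₃ + 2 * c₉ + 200) + d + c₁ + c₂ + c₃ + c₉ + 20,
    ?_⟩
  intro V α K D s δ n h S φ inc hS hs hδ hD hφ hΔ hinc hall hcov hdis hh
  have hSpos : 0 < S.card := Nat.pos_of_ne_zero fun h => hS (by simp [h])
  -- transport to `Fin N`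
  let ι : Fin S.card ↪ α := S.equivFin.symm.toEmbedding.trans (Function.Embedding.subtype _)
  have hι : ∀ i, ι i ∈ S := fun i => (S.equivFin.symm i).2
  have hιs : ∀ v ∈ S, ∃ i, ι i = v := fun v hv => ⟨S.equivFin ⟨v, hv⟩, by simp [ι]⟩
  let ψ : Finset (Fin S.card) → PForm V := fun e => φ (e.map ι)
  have hmapS : ∀ e : Finset (Fin S.card), e.map ι ⊆ S := fun e v hv => by
    obtain ⟨i, _, rfl⟩ := Finset.mem_map.1 hv; exact hι i
  have hpre : ∀ e ⊆ S, ∃ e' : Finset (Fin S.card), e'.map ι = e := fun e he =>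
    ⟨Finset.univ.filter fun i => ι i ∈ e, by
      ext v
      simp only [Finset.mem_map, Finset.mem_filter, Finset.mem_univ, true_and]
      exact ⟨fun ⟨i, hi, h⟩ => h ▸ hi, fun hv => by
        obtain ⟨i, rfl⟩ := hιs v (he hv); exact ⟨i, hv, rfl⟩⟩⟩
  let X : Fin S.card → List (PForm V) := fun v =>
    ((edgesAt m Finset.univ v).toList.map fun e => neg (ψ e)).map neg
  let lA : List (PForm V) := (Finset.univ : Finset (Fin S.card)).toList.map fun v => neg (or (X v))
  -- If `e` and `f` meet in `v`, each is listed in `inc v` or has formula FALSE. So these lists,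
  -- with FALSE ∧ FALSE, contain every conflict disjunct of the axiom, and their total length is
  -- linear in `S.card`.
  let pairs : α → List (PForm V) := fun v =>
    (inc v).map (fun e => conj [φ e, fls]) ++ ((inc v).map (fun e => conj [fls, φ e]) ++
      (((inc v) ×ˢ (inc v)).filter fun q => q.1 ≠ q.2).map fun q => conj [φ q.1, φ q.2])
  let lB : List (PForm V) := conj [fls, fls] :: S.toList.flatMap pairs
  let Y : List (PForm V) := (conflictPairs m (Finset.univ : Finset (Fin S.card))).toList.map
    fun q => conj [ψ q.1, ψ q.2]
  have hcount : or [or lA, or Y] ∈ countingAxioms V m := ⟨S.card, hS, ψ, rfl⟩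
  -- sizes
  obtain ⟨P, hP⟩ : ∃ P, P = (Δ + 1) * (s + 1) := ⟨_, rfl⟩
  have hr1 : r * (s + 1) = 2 * P + 10 * (s + 1) := by rw [hr, hP]; ring
  have hP1 : (Δ + 1) * (s + 2) ≤ 2 * P := by
    rw [hP, mul_left_comm]; exact Nat.mul_le_mul_left _ (by omega)
  have hP2 : Δ * s ≤ P := by rw [hP]; exact Nat.mul_le_mul (by omega) (by omega)
  obtain ⟨t, ht⟩ : ∃ t, t + 1 = r * (s + 1) := ⟨r * (s + 1) - 1, by omega⟩
  have hconj : ∀ A B : PForm V, Within s δ A → Within s δ B → Within t (δ + 6) (conj [A, B]) :=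
    fun A B hA hB => (hA.conj_pair hB).mono (by omega) (by omega)
  have hfls : Within s δ (fls : PForm V) := fls_within.mono hs hδ
  -- All unlisted edges at a vertex contribute the same input `¬¬FALSE`. Thus at most `Δ + 1`
  -- distinct inputs count for the size, however many edges of the complete hypergraph pass through
  -- the vertex.
  have hXsub : ∀ v, X v ⊆ neg (neg fls) :: (inc (ι v)).map fun e => neg (neg (φ e)) := by
    intro v A hA
    simp only [X, List.mem_map, Finset.mem_toList, mem_edgesAt] at hA
    obtain ⟨_, ⟨e, ⟨⟨_, he⟩, hv⟩, rfl⟩, rfl⟩ := hA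
    rcases hall (e.map ι) (hmapS e) (by simpa using he) (ι v) (by simpa using hv) with h | h
    · exact List.mem_cons_of_mem _ (List.mem_map.2 ⟨_, h, rfl⟩)
    · simp only [ψ, h, List.mem_cons, true_or]
  have hXW : ∀ v, Within t (δ + 5) (or (X v)) := by
    intro v
    refine Within.of_subset (hXsub v) ((Within.or_of_forall (s := s + 2) (δ := δ + 2) ?_).mono ?_
      (by omega))
    · intro A hA
      rcases List.mem_cons.1 hA with rfl | hA
      · exact hfls.neg_neg
      · obtain ⟨e, _, rfl⟩ := List.mem_map.1 hA
        exact (hφ e).neg_neg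
    · simp only [List.length_cons, List.length_map]
      have := Nat.mul_le_mul_right (s + 2) (Nat.add_le_add_right (hΔ (ι v)) 1)
      omega
  have hlB : ∀ A ∈ lB, Within t (δ + 6) A := by
    intro A hA
    simp only [lB, List.mem_cons, List.mem_flatMap, pairs, List.mem_append, List.mem_map,
      List.mem_filter] at hA
    rcases hA with rfl | ⟨v, _, ⟨e, _, rfl⟩ | ⟨e, _, rfl⟩ | ⟨q, _, rfl⟩⟩
    exacts [hconj _ _ hfls hfls, hconj _ _ (hφ _) hfls, hconj _ _ hfls (hφ _),
      hconj _ _ (hφ _) (hφ _)]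
  have hW : ∀ A ∈ lA ++ lB, Within (t + 1) (δ + 6) A := by
    intro A hA
    rcases List.mem_append.1 hA with hA | hA
    · obtain ⟨v, _, rfl⟩ := List.mem_map.1 hA
      exact (hXW v).neg
    · exact (hlB A hA).mono (by omega) le_rfl
  -- refuting the disjuncts
  have hn : n * (s + 1) ≤ n * (t + 1) := by
    exact Nat.mul_le_mul_left _ (by omega)
  have hnegA : ∀ v, Proves (countingAxioms V m) D K (((Δ + 1) * (n + d)) * (t + 1))
      {neg (neg (or (X v)))} := by
    intro v
    have hcovW : Within t (δ + 5) (or ((inc (ι v)).map φ)) := by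
      refine (Within.or_of_forall (s := s) (δ := δ) ?_).mono ?_ (by omega)
      · intro A hA
        obtain ⟨e, _, rfl⟩ := List.mem_map.1 hA
        exact hφ e
      · rw [List.length_map]
        have := Nat.mul_le_mul_right s (hΔ (ι v))
        omega
    have e₁ : ∀ A ∈ (inc (ι v)).map φ, Proves (countingAxioms V m) D K ((c₁ + c₄) * (t + 1))
        {or [neg A, or (X v)]} := by
      intro A hA
      obtain ⟨e, he, rfl⟩ := List.mem_map.1 hA
      obtain ⟨hve, heS, hem⟩ := hinc _ (hι v) e he
      obtain ⟨e', rfl⟩ := hpre e heS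
      have hmem : neg (neg (φ (e'.map ι))) ∈ X v := by
        simp only [X, List.mem_map, Finset.mem_toList, mem_edgesAt]
        exact ⟨_, ⟨e', ⟨⟨Finset.subset_univ _, by simpa using hem⟩, by simpa using hve⟩, rfl⟩, rfl⟩
      refine (h₄ (δ := δ + 5) ![φ (e'.map ι), or (X v)] (by omega)
        (.forall₂ ((hφ _).mono (by omega) (by omega)) (hXW v))
        (.cons (imp_mem hmem (hXW v) (by omega)) .nil)).cost (Nat.mul_le_mul_right _ ?_)
      simp
    have e₂ := or_elim hcovW (hXW v) (by omega) e₁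
    refine (h₅ (δ := δ + 5) ![_, or (X v)] (by omega) (.forall₂ hcovW (hXW v))
      (.cons e₂ (.cons ((hcov _ (hι v)).cost hn) .nil))).cost (Nat.mul_le_mul_right _ ?_)
    simp only [List.sum_cons, List.sum_nil, List.length_map]
    have := Nat.mul_le_mul_right (c₁ + c₄ + c₂) (hΔ (ι v))
    have h2 : n + d ≤ (Δ + 1) * (n + d) := Nat.le_mul_of_pos_left _ (by omega)
    omega
  have hcost : (n + d) * (t + 1) ≤ ((Δ + 1) * (n + d)) * (t + 1) := by
    gcongr; exact Nat.le_mul_of_pos_left _ (by omega)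
  have hW' : ∀ A : PForm V, Within s δ A → Within t (δ + 5) A := fun A hA =>
    hA.mono (by omega) (by omega)
  have hneg : ∀ A ∈ lA ++ lB, Proves (countingAxioms V m) D K (((Δ + 1) * (n + d)) * (t + 1))
      {neg A} := by
    intro A hA
    rcases List.mem_append.1 hA with hA | hA
    · obtain ⟨v, _, rfl⟩ := List.mem_map.1 hA
      exact hnegA v
    · simp only [lB, List.mem_cons, List.mem_flatMap, pairs, List.mem_append, List.mem_map,
        List.mem_filter, Finset.mem_toList] at hA
      rcases hA with rfl | ⟨v, hv, ⟨e, he, rfl⟩ | ⟨e, he, rfl⟩ | ⟨⟨e, f⟩, ⟨hq, hne⟩, rfl⟩⟩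
      · refine (h₇ (δ := δ + 5) (ns := []) ![fls] (by omega) (.forall₁ (hW' _ hfls)) .nil).cost
          ((Nat.mul_le_mul_right _ ?_).trans hcost)
        simp; omega
      · refine (h₇ (δ := δ + 5) (ns := []) ![φ e] (by omega) (.forall₁ (hW' _ (hφ e))) .nil).cost
          ((Nat.mul_le_mul_right _ ?_).trans hcost)
        simp; omega
      · refine (h₈ (δ := δ + 5) (ns := []) ![φ e] (by omega) (.forall₁ (hW' _ (hφ e))) .nil).cost
          ((Nat.mul_le_mul_right _ ?_).trans hcost)
        simp; omega
      · have hq := List.pair_mem_product.1 hq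
        refine (h₆ (δ := δ + 5) ![φ e, φ f] (by omega)
          (.forall₂ (hW' _ (hφ e)) (hW' _ (hφ f)))
          (.cons ((hdis v hv e hq.1 f hq.2 (by simpa using hne)).cost hn) .nil)).cost
          ((Nat.mul_le_mul_right _ ?_).trans hcost)
        simp; omega
  have hlen : (lA ++ lB).length ≤ (a + 1) * S.card := by
    have hp : ∀ v, (pairs v).length ≤ Δ + (Δ + Δ * Δ) := by
      intro v
      simp only [pairs, List.length_append, List.length_map]
      have h1 := hΔ v
      have h2 := (List.length_filter_le (fun q : Finset α × Finset α => decide (q.1 ≠ q.2))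
        (inc v ×ˢ inc v)).trans (List.length_product (inc v) (inc v)).le
      have h3 := Nat.mul_le_mul h1 h1
      omega
    have h1 : (S.toList.flatMap pairs).length ≤ S.card * (Δ + (Δ + Δ * Δ)) := by
      rw [List.length_flatMap, ← Finset.length_toList S]
      exact (List.sum_le_card_nsmul _ _ (by simpa using fun v _ => hp v)).trans (by simp)
    simp only [lA, lB, List.length_append, List.length_map, List.length_cons, Finset.length_toList,
      Finset.card_univ, Fintype.card_fin]
    rw [ha]
    nlinarith
  have hlenh : (lA ++ lB).length ≤ 2 ^ h := by
    refine hlen.trans (le_trans (Nat.mul_le_mul_right _ ?_) hh)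
    have : (a + 1) * 1 ≤ (a + 1) * r * ((Δ + 1) * (d + 1)) := by
      rw [mul_assoc]
      exact Nat.mul_le_mul_left _ (Nat.one_le_iff_ne_zero.2 (by simp [hr]))
    omega
  -- The short list `lA ++ lB` is refuted instead of the axiom itself. Both disjunctions of the
  -- axiom have their inputs among its members, and the passage from one to the other needs only
  -- `imp_of_subset`.
  have hrefute := neg_or (by omega) h (lA ++ lB) hlenh hW hneg
  -- the axiom
  have hYB : Y ⊆ lA ++ lB := by
    intro A hA
    simp only [Y, List.mem_map, Finset.mem_toList, mem_conflictPairs] at hA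
    obtain ⟨⟨e, f⟩, ⟨⟨_, he⟩, ⟨_, hf⟩, hne, hdj⟩, rfl⟩ := hA
    simp only at he hf hne hdj
    obtain ⟨i, hi, hi'⟩ := Finset.not_disjoint_iff.1 hdj
    refine List.mem_append_right _ ?_
    simp only [lB, List.mem_cons, List.mem_flatMap, pairs, List.mem_append, List.mem_map,
      List.mem_filter, Finset.mem_toList]
    rcases hall (e.map ι) (hmapS e) (by simpa using he) (ι i) (by simpa using hi) with h₁ | h₁ <;>
      rcases hall (f.map ι) (hmapS f) (by simpa using hf) (ι i) (by simpa using hi') with h₂ | h₂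
    · refine .inr ⟨ι i, hι i, .inr (.inr ⟨(e.map ι, f.map ι), ⟨List.pair_mem_product.2 ⟨h₁, h₂⟩, ?_⟩,
        rfl⟩)⟩
      simpa using hne
    · exact .inr ⟨ι i, hι i, .inl ⟨_, h₁, by simp only [ψ, h₂]⟩⟩
    · exact .inr ⟨ι i, hι i, .inr (.inl ⟨_, h₂, by simp only [ψ, h₁]⟩)⟩
    · left; simp only [ψ, h₁, h₂]
  obtain ⟨u, hu⟩ : ∃ u, u = 1 + 2 ^ h * (t + 1) := ⟨_, rfl⟩
  have hWu : Within u (δ + 7) (or (lA ++ lB)) :=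
    (Within.or_of_forall hW).mono (by rw [hu]; gcongr) le_rfl
  have hWA : Within u (δ + 7) (or lA) := .of_subset (by simp) hWu
  have hWY : Within u (δ + 7) (or Y) := .of_subset hYB hWu
  have hax : Proves (countingAxioms V m) D (K ∪ {neg (or (lA ++ lB))}) (2 * (u + 1))
      {or [or lA, or Y]} := by
    refine axm hcount ?_ ?_
    · have := size_pair_le (or lA) (or Y)
      have := hWA.1
      have := hWY.1
      omega
    · have := hWA.2
      have := hWY.2
      refine (depth_or_le (n := δ + 7) ?_).trans (by omega)
      simp [hWA.2, hWY.2]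
  have hfin := hrefute.bind (h₉ (δ := δ + 7) (ns := [2, 30, 30, 0])
    ![or lA, or Y, or (lA ++ lB)] (by omega)
    (.forall₃ hWA hWY hWu) (.cons hax (.cons (imp_of_subset (by simp) hWu (by omega))
      (.cons (imp_of_subset hYB hWu (by omega)) (.cons (of_mem (.inr rfl)) .nil)))))
  refine hfin.cost ?_
  have k₁ : (lA ++ lB).length * ((Δ + 1) * (n + d) * (t + 1)) ≤
      ((a + 1) * r * ((Δ + 1) * (d + 1))) * S.card * (n + d) * (s + 1) := by
    calc _ ≤ (a + 1) * S.card * ((Δ + 1) * (n + d) * (t + 1)) := Nat.mul_le_mul_right _ hlen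
      _ = ((a + 1) * r * ((Δ + 1) * 1)) * S.card * (n + d) * (s + 1) := by rw [ht]; ring
      _ ≤ _ := by gcongr; omega
  have hpow := Nat.one_le_two_pow (n := h)
  have k₂ : u + 1 ≤ 2 ^ h * (2 * r * (s + 1)) := by
    rw [hu]
    calc _ = 2 + 2 ^ h * (t + 1) := by ring
      _ ≤ 2 ^ h * 2 + 2 ^ h * (t + 1) := by omega
      _ = 2 ^ h * (t + 3) := by ring
      _ ≤ _ := by
        gcongr
        rw [mul_assoc, ← ht]; omega
  have k₃ : c₃ * (h + 1) * 2 ^ h * (t + 1 + 1) ≤ (2 * c₃ * r) * (h + 1) * 2 ^ h * (s + 1) := by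
    calc _ ≤ c₃ * (h + 1) * 2 ^ h * (2 * (t + 1)) := by gcongr; omega
      _ = _ := by rw [ht]; ring
  simp only [List.sum_cons, List.sum_nil, add_zero]
  have k₄ : (2 + (30 + 30) + c₉) * (u + 1) ≤ (r * (2 * c₉ + 124)) * (h + 1) * 2 ^ h * (s + 1) := by
    calc _ ≤ (62 + c₉) * (2 ^ h * (2 * r * (s + 1))) := Nat.mul_le_mul_left _ k₂
      _ = (r * (2 * c₉ + 124)) * 1 * 2 ^ h * (s + 1) := by ring
      _ ≤ _ := by gcongr; omega
  obtain ⟨c, hc⟩ : ∃ c, c = (a + 1) * r * ((Δ + 1) * (d + 1)) + r * (2 * c₃ + 2 * c₉ + 200) + d +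
    c₁ + c₂ + c₃ + c₉ + 20 := ⟨_, rfl⟩
  rw [← hc]
  have k₅ : ((a + 1) * r * ((Δ + 1) * (d + 1))) * S.card * (n + d) * (s + 1) ≤
      c * S.card * (n + c) * (s + 1) := by
    gcongr <;> omega
  have k₆ : (2 * c₃ * r) * (h + 1) * 2 ^ h * (s + 1) +
      (r * (2 * c₉ + 124)) * (h + 1) * 2 ^ h * (s + 1) ≤ c * (h + 1) * 2 ^ h * (s + 1) := by
    rw [← add_mul, ← add_mul, ← add_mul]
    gcongr
    have : 2 * c₃ * r + r * (2 * c₉ + 124) ≤ r * (2 * c₃ + 2 * c₉ + 200) := by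
      rw [mul_comm (2 * c₃), ← mul_add]; exact Nat.mul_le_mul_left _ (by omega)
    omega
  rw [add_mul (c * S.card * (n + c))]
  omega

-- Chains of mutually exclusive formulas

/-- The formula `J ∧ (T₀ ∨ ⋯ ∨ T_{t-1})`. -/
def prefixConj (J : PForm V) (T : List (PForm V)) (t : ℕ) : PForm V := conj [J, or (T.take t)]

/-- The local facts about a chain of formulas `J ∧ (T₀ ∨ ⋯ ∨ T_{t-1})` whose members `T_i` are
mutually exclusive. -/
structure ChainFacts (Ax : Set (PForm V)) (D : ℕ) (K : Set (PForm V)) (n : ℕ) (T : List (PForm V))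
    (J Q : PForm V) : Prop where
  step : ∀ t (h : t < T.length), Proves Ax D K n
    {or [neg (prefixConj J T (t + 1)), prefixConj J T t, conj [J, T[t]]]}
  first : ∀ h : 0 < T.length, Proves Ax D K n {or [neg (prefixConj J T 1), conj [J, T[0]]]}
  em : ∀ t, Proves Ax D K n {or [neg (prefixConj J T t), prefixConj J T t]}
  last : Proves Ax D K n {or [prefixConj J T T.length, neg Q]}
  last_nil : T = [] → Proves Ax D K n {or [neg Q]}
  mono : ∀ t < T.length, Proves Ax D K n
    {or [neg (neg (prefixConj J T (t + 1))), neg (prefixConj J T t)]}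
  mem : ∀ t (h : t < T.length), Proves Ax D K n
    {or [neg (neg (prefixConj J T (t + 1))), neg (conj [J, T[t]])]}
  disjoint : ∀ t (h : t < T.length), Proves Ax D K n
    {or [neg (prefixConj J T t), neg (conj [J, T[t]])]}
  neg_em : ∀ t, Proves Ax D K n {or [neg (neg (prefixConj J T t)), neg (prefixConj J T t)]}
  last_disjoint : Proves Ax D K n {or [neg (prefixConj J T T.length), neg (neg Q)]}

/-- The further facts about such a chain if `Q` is valid. -/
structure ChainFactsTrue (Ax : Set (PForm V)) (D : ℕ) (K : Set (PForm V)) (n : ℕ)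
    (T : List (PForm V)) (J : PForm V) : Prop where
  last : Proves Ax D K n {or [prefixConj J T T.length]}
  last_nil : T = [] → Proves Ax D K n {or []}

/-- With `P_t` for `prefixConj J T t`, `P_{t+1}` is equivalent to the disjunction of `P_t` and `J ∧
T_t`, and these two exclude each other because `T_t` excludes all earlier members. Since `I` is
equivalent to `⋁T` and `Q` to `J ∧ I`, the chain ends in a formula equivalent to `Q`. Only
`disjoint` and `last_disjoint` run through the list `T`; they cause the factor `T.length`. -/
theorem chainFacts : ∃ c : ℕ, ∀ {V : Type} {Ax K : Set (PForm V)} {D s δ n : ℕ}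
    {T : List (PForm V)} {J I Q : PForm V}, δ + c ≤ D → Within s δ (or T) → Within s δ J →
    Within s δ I → Within s δ Q → (∀ A ∈ T, Proves Ax D K (n * (s + 1)) {or [neg A, I]}) →
    T.Pairwise (fun A B => Proves Ax D K (n * (s + 1)) {or [neg A, neg B]}) →
    Proves Ax D K (n * (s + 1)) {or [neg I, or T]} →
    Proves Ax D K (n * (s + 1)) {or [neg Q, J]} → Proves Ax D K (n * (s + 1)) {or [neg Q, I]} →
    Proves Ax D K (n * (s + 1)) {or [neg J, or [neg I, Q]]} →
    ChainFacts Ax D K (2 * (T.length + 4) * (n + c) * (s + 1)) T J Q ∧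
      (Proves Ax D K (n * (s + 1)) {Q} →
        ChainFactsTrue Ax D K (2 * (T.length + 4) * (n + c) * (s + 1)) T J) := by
  obtain ⟨c₀, imp_mem⟩ := Proves.imp_mem
  obtain ⟨c₁, or_elim⟩ := Proves.or_elim
  obtain ⟨c₂, h₂⟩ := Proves.taut (k := 4) [or [or [neg (var 0), var 1], or [var 2]]]
    (or [neg (conj [var 3, var 0]), conj [var 3, var 1], conj [var 3, var 2]])
    (by intro v; simp [eval, evalList, conj]; tauto)
  obtain ⟨c₃, h₃⟩ := Proves.taut (k := 3) [or [or [neg (var 0), or []], or [var 1]]]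
    (or [neg (conj [var 2, var 0]), conj [var 2, var 1]])
    (by intro v; simp [eval, evalList, conj]; tauto)
  obtain ⟨c₄, h₄⟩ := Proves.taut (k := 2) []
    (or [neg (conj [var 1, var 0]), conj [var 1, var 0]])
    (by intro v; simp [eval, evalList, conj]; tauto)
  obtain ⟨c₅, h₅⟩ := Proves.taut (k := 4)
    [or [neg (var 0), var 1], or [neg (var 0), var 2], or [neg (var 2), var 3]]
    (or [conj [var 1, var 3], neg (var 0)])
    (by intro v; simp [eval, evalList, conj]; tauto)
  obtain ⟨c₆, h₆⟩ := Proves.taut (k := 2)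
    [or [neg (var 0), var 1], or [neg (var 1), or []]] (or [neg (var 0)])
    (by intro v; simp [eval, evalList]; tauto)
  obtain ⟨c₇, h₇⟩ := Proves.taut (k := 3) [or [neg (var 0), var 1]]
    (or [neg (neg (conj [var 2, var 1])), neg (conj [var 2, var 0])])
    (by intro v; simp [eval, evalList, conj]; tauto)
  obtain ⟨c₈, h₈⟩ := Proves.taut (k := 3) [or [neg (var 0), neg (var 1)]]
    (or [neg (conj [var 2, var 0]), neg (conj [var 2, var 1])])
    (by intro v; simp [eval, evalList, conj]; tauto)
  obtain ⟨c₉, h₉⟩ := Proves.taut (k := 2) []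
    (or [neg (neg (conj [var 1, var 0])), neg (conj [var 1, var 0])])
    (by intro v; simp [eval, evalList, conj]; tauto)
  obtain ⟨c₁₀, h₁₀⟩ := Proves.taut (k := 4)
    [or [neg (var 0), or [neg (var 1), var 2]], or [neg (var 3), var 1]]
    (or [neg (conj [var 0, var 3]), neg (neg (var 2))])
    (by intro v; simp [eval, evalList, conj]; tauto)
  obtain ⟨c₁₁, h₁₁⟩ := Proves.taut (k := 4)
    [or [neg (var 0), var 1], or [neg (var 0), var 2], or [neg (var 2), var 3], var 0]
    (or [conj [var 1, var 3]])
    (by intro v; simp [eval, evalList, conj]; tauto)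
  obtain ⟨c₁₂, h₁₂⟩ := Proves.taut (k := 2)
    [or [neg (var 0), var 1], or [neg (var 1), or []], var 0] (or [])
    (by intro v; simp [eval, evalList]; tauto)
  obtain ⟨d, hd⟩ : ∃ d, d = c₀ + c₁ + c₂ + c₃ + c₄ + c₅ + c₆ + c₇ + c₈ + c₉ + c₁₀ + c₁₁ + c₁₂ + 40 :=
    ⟨_, rfl⟩
  refine ⟨d, ?_⟩
  intro V Ax K D s δ n T J I Q hD hT hJ hI hQ hTI hTT hIT hQJ hQI hJIQ
  have hP : ∀ t, Within s δ (or (T.take t)) := fun t => hT.of_subset (List.take_subset _ _)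
  have hx : ∀ t (h : t < T.length), Within s δ T[t] := fun t h => hT.of_mem (List.getElem_mem h)
  have cost : ∀ a, a ≤ 4 * (n + d) → a * (s + 1) ≤ 2 * (T.length + 4) * (n + d) * (s + 1) :=
    fun a ha => Nat.mul_le_mul_right _ (ha.trans (Nat.mul_le_mul_right _ (by omega)))
  have hsplit : ∀ t (h : t < T.length), Proves Ax D K (30 * (s + 1))
      {or [or [neg (or (T.take (t + 1))), or (T.take t)], or [T[t]]]} := fun t h =>
    .split (fun A => by rw [List.take_succ_eq_append_getElem h, List.mem_append]) (hP _) (by omega)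
  constructor
  · constructor
    · intro t h
      exact (h₂ (δ := δ) ![_, _, T[t], J] (by omega) (.forall₄ (hP (t + 1)) (hP t) (hx t h) hJ)
        (.cons (hsplit t h) .nil)).cost (cost _ (by simp; omega))
    · intro h
      exact (h₃ (δ := δ) ![_, T[0], J] (by omega) (.forall₃ (hP 1) (hx 0 h) hJ)
        (.cons (hsplit 0 h) .nil)).cost (cost _ (by simp; omega))
    · intro t
      exact (h₄ (δ := δ) (ns := []) ![_, J] (by omega) (.forall₂ (hP t) hJ) .nil).cost
        (cost _ (by simp; omega))
    · rw [prefixConj, List.take_length]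
      exact (h₅ (δ := δ) ![Q, J, I, or T] (by omega) (.forall₄ hQ hJ hI hT)
        (.cons hQJ (.cons hQI (.cons hIT .nil)))).cost (cost _ (by simp; omega))
    · rintro rfl
      exact (h₆ (δ := δ) ![Q, I] (by omega) (.forall₂ hQ hI)
        (.cons hQI (.cons hIT .nil))).cost (cost _ (by simp; omega))
    · intro t h
      have : Proves Ax D K (30 * (s + 1)) {or [neg (or (T.take t)), or (T.take (t + 1))]} :=
        .imp_of_subset (by
          rw [List.take_succ_eq_append_getElem h]; exact List.subset_append_left _ _) (hP _) (by omega)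
      exact (h₇ (δ := δ) ![_, _, J] (by omega) (.forall₃ (hP t) (hP (t + 1)) hJ)
        (.cons this .nil)).cost (cost _ (by simp; omega))
    · intro t h
      have : Proves Ax D K (c₀ * (s + 1)) {or [neg T[t], or (T.take (t + 1))]} :=
        imp_mem (by
          rw [List.take_succ_eq_append_getElem h]
          exact List.mem_append_right _ (List.mem_singleton_self _)) (hP _) (by omega)
      exact (h₇ (δ := δ) ![_, _, J] (by omega) (.forall₃ (hx t h) (hP (t + 1)) hJ)
        (.cons this .nil)).cost (cost _ (by simp; omega))
    · intro t h
      have : Proves Ax D K (((T.take t).length * (n + c₁) + c₁) * (s + 1 + 1))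
          {or [neg (or (T.take t)), neg T[t]]} := by
        refine or_elim (s := s + 1) (δ := δ + 1) ((hP t).mono (by omega) (by omega)) (hx t h).neg
          (by omega) fun A hA => ?_
        obtain ⟨u, hu, rfl⟩ := List.mem_take_iff_getElem.1 hA
        exact (List.pairwise_iff_getElem.1 hTT u t (by omega) h (by omega)).cost
          (Nat.mul_le_mul_left _ (by omega))
      have := this.cost (n' := 2 * (T.length * (n + c₁) + c₁) * (s + 1)) (by
        rw [mul_assoc, mul_left_comm]
        refine Nat.mul_le_mul ?_ (by omega)
        gcongr
        simp)
      refine (h₈ (δ := δ) ![_, T[t], J] (by omega) (.forall₃ (hP t) (hx t h) hJ)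
        (.cons this .nil)).cost (Nat.mul_le_mul_right _ ?_)
      have : T.length * (n + c₁) ≤ T.length * (n + d) := Nat.mul_le_mul_left _ (by omega)
      simp only [List.sum_cons, List.sum_nil]
      linarith
    · intro t
      exact (h₉ (δ := δ) (ns := []) ![_, J] (by omega) (.forall₂ (hP t) hJ) .nil).cost
        (cost _ (by simp; omega))
    · rw [prefixConj, List.take_length]
      have h := or_elim hT hI (by omega) hTI
      refine (h₁₀ (δ := δ) ![J, I, Q, or T] (by omega) (.forall₄ hJ hI hQ hT)
        (.cons hJIQ (.cons h .nil))).cost (Nat.mul_le_mul_right _ ?_)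
      have : T.length * (n + c₁) ≤ T.length * (n + d) := Nat.mul_le_mul_left _ (by omega)
      simp only [List.sum_cons, List.sum_nil]
      have := Nat.zero_le (T.length * (n + d))
      linarith
  · intro hQt
    constructor
    · rw [prefixConj, List.take_length]
      exact (h₁₁ (δ := δ) ![Q, J, I, or T] (by omega) (.forall₄ hQ hJ hI hT)
        (.cons hQJ (.cons hQI (.cons hIT (.cons hQt .nil))))).cost (cost _ (by simp; omega))
    · rintro rfl
      exact (h₁₂ (δ := δ) ![Q, I] (by omega) (.forall₂ hQ hI)
        (.cons hQI (.cons hIT (.cons hQt .nil)))).cost (cost _ (by simp; omega))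

/-- The data from which a perfect `m`-partition is built: blocks `b ∈ B` with point sets `M b`,
formulas `θ b E` for the parts `E` of the points of `b`, a condition `J b` under which these parts
are used, formulas `Q z` saying that the point `z` belongs to a used part, and groups of points for
those that do not. The points with `triv z` are in no group. -/
structure ChainGadget (V ι κ : Type) where
  m : ℕ
  B : Finset ι
  M : ι → Finset κ
  θ : ι → Finset κ → PForm V
  J : ι → PForm V
  Q : ι × κ → PForm V
  triv : ι × κ → Prop
  grp : ι × κ → Finset (ι × κ)

-- The hypergraph of the chains

namespace ChainGadget

variable {ι κ : Type} (G : ChainGadget V ι κ)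

/-- The parts that contain a point. -/
noncomputable def edges (z : ι × κ) : List (Finset κ) := (edgesAt G.m (G.M z.1) z.2).toList

/-- The formulas of the parts that contain a point. -/
noncomputable def forms (z : ι × κ) : List (PForm V) := (G.edges z).map (G.θ z.1)

/-- The number of parts that contain a point: the length of the chain at this point. -/
noncomputable abbrev len (z : ι × κ) : ℕ := (G.edges z).length

open Classical in
/-- All points of all blocks. -/
noncomputable def points : Finset (ι × κ) := G.B.biUnion fun b => (G.M b).image fun q => (b, q)

open Classical in
/-- The vertices: a chain of `m * len z + 1` vertices at each point `z`. -/
noncomputable def vertices : Finset ((ι × κ) × ℕ × ℕ) :=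
  G.points.biUnion fun z =>
    (insert (G.len z, 0) (Finset.range (G.len z) ×ˢ Finset.range G.m)).image fun p => (z, p)

open Classical in
/-- The edge on the vertices of level `t` of a chain. -/
noncomputable def levelEdge (z : ι × κ) (t : ℕ) : Finset ((ι × κ) × ℕ × ℕ) :=
  (Finset.range G.m).image fun k => (z, t, k)

open Classical in
/-- The edge between two levels of a chain. -/
noncomputable def linkEdge (z : ι × κ) (t : ℕ) : Finset ((ι × κ) × ℕ × ℕ) :=
  insert (z, t + 1, 0) ((Finset.range (G.m - 1)).image fun k => (z, t, k + 1))

open Classical in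
/-- The edge representing a part. -/
noncomputable def partEdge (b : ι) (E : Finset κ) : Finset ((ι × κ) × ℕ × ℕ) :=
  E.image fun q => ((b, q), (G.edges (b, q)).idxOf E, 0)

open Classical in
/-- The edge on the last vertices of the chains of a group. -/
noncomputable def groupEdge (z : ι × κ) : Finset ((ι × κ) × ℕ × ℕ) :=
  (G.grp z).image fun z => (z, G.len z, 0)

/-- The formula attached to an edge. -/
inductive EdgeForm : Finset ((ι × κ) × ℕ × ℕ) → PForm V → Prop where
  | level {z : ι × κ} {t : ℕ} : z ∈ G.points → t < G.len z →
      EdgeForm (G.levelEdge z t) (neg (prefixConj (G.J z.1) (G.forms z) (t + 1)))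
  | link {z : ι × κ} {t : ℕ} : z ∈ G.points → t < G.len z →
      EdgeForm (G.linkEdge z t) (prefixConj (G.J z.1) (G.forms z) (t + 1))
  | part {b : ι} {E : Finset κ} : b ∈ G.B → E ⊆ G.M b → E.card = G.m →
      EdgeForm (G.partEdge b E) (conj [G.J b, G.θ b E])
  | group {z : ι × κ} : z ∈ G.points → ¬ G.triv z → EdgeForm (G.groupEdge z) (neg (G.Q z))

open Classical in
/-- The formula substituted for the variable of an edge. -/
noncomputable def edgeVar (e : Finset ((ι × κ) × ℕ × ℕ)) : PForm V :=
  if h : ∃ A, G.EdgeForm e A then h.choose else fls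

/-- The link edge that ends in level `t`. -/
noncomputable def linksBefore (z : ι × κ) : ℕ → List (Finset ((ι × κ) × ℕ × ℕ))
  | 0 => []
  | t + 1 => [G.linkEdge z t]

open Classical in
/-- The edges at a vertex. -/
noncomputable def inc (v : (ι × κ) × ℕ × ℕ) : List (Finset ((ι × κ) × ℕ × ℕ)) :=
  if v.2.1 < G.len v.1 then
    if v.2.2 = 0 then
      G.levelEdge v.1 v.2.1 :: (G.linksBefore v.1 v.2.1 ++
        [G.partEdge v.1.1 ((G.edges v.1).getD v.2.1 ∅)])
    else [G.levelEdge v.1 v.2.1, G.linkEdge v.1 v.2.1]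
  else G.linksBefore v.1 v.2.1 ++ if G.triv v.1 then [] else [G.groupEdge v.1]

/-- The groups have `m` points each and partition the points that are not `triv`. -/
structure IsGrouped : Prop where
  mem : ∀ z ∈ G.points, ¬ G.triv z → z ∈ G.grp z
  subset : ∀ z ∈ G.points, ¬ G.triv z → G.grp z ⊆ G.points
  card : ∀ z ∈ G.points, ¬ G.triv z → (G.grp z).card = G.m
  compat : ∀ z ∈ G.points, ¬ G.triv z → ∀ w ∈ G.grp z,
    G.grp w = G.grp z ∧ ¬ G.triv w ∧ G.Q w = G.Q z

variable {G}

theorem mem_points {z : ι × κ} : z ∈ G.points ↔ z.1 ∈ G.B ∧ z.2 ∈ G.M z.1 := by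
  simp only [points, Finset.mem_biUnion, Finset.mem_image]
  constructor
  · rintro ⟨b, hb, q, hq, rfl⟩; exact ⟨hb, hq⟩
  · exact fun h => ⟨z.1, h.1, z.2, h.2, rfl⟩

theorem mem_edges {z : ι × κ} {E : Finset κ} :
    E ∈ G.edges z ↔ (E ⊆ G.M z.1 ∧ E.card = G.m) ∧ z.2 ∈ E := by
  rw [edges, Finset.mem_toList, mem_edgesAt]

theorem nodup_edges (z : ι × κ) : (G.edges z).Nodup := Finset.nodup_toList _

theorem mem_vertices {v : (ι × κ) × ℕ × ℕ} : v ∈ G.vertices ↔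
    v.1 ∈ G.points ∧ ((v.2.1 < G.len v.1 ∧ v.2.2 < G.m) ∨ (v.2.1 = G.len v.1 ∧ v.2.2 = 0)) := by
  obtain ⟨z, t, k⟩ := v
  simp only [vertices, Finset.mem_biUnion, Finset.mem_image, Finset.mem_insert, Finset.mem_product,
    Finset.mem_range, Prod.mk.injEq]
  constructor
  · rintro ⟨z', hz, p, hp, rfl, rfl⟩
    refine ⟨hz, ?_⟩
    simp only [Prod.mk.injEq] at hp
    tauto
  · rintro ⟨hz, h⟩
    exact ⟨z, hz, (t, k), by simp only [Prod.mk.injEq]; tauto, rfl, rfl⟩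

theorem card_vertices : G.vertices.card = ∑ z ∈ G.points, (G.len z * G.m + 1) := by
  classical
  rw [vertices, Finset.card_biUnion]
  · refine Finset.sum_congr rfl fun z _ => ?_
    rw [Finset.card_image_of_injective _ (fun a b h => by simpa using h),
      Finset.card_insert_of_notMem (by simp), Finset.card_product, Finset.card_range,
      Finset.card_range]
  · intro z _ w _ hzw
    rw [Function.onFun, Finset.disjoint_left]
    rintro v hv hw
    obtain ⟨_, _, rfl⟩ := Finset.mem_image.1 hv
    obtain ⟨_, _, h⟩ := Finset.mem_image.1 hw
    exact hzw (by simpa using (congrArg Prod.fst h).symm)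

theorem mem_levelEdge {z w : ι × κ} {t u k : ℕ} :
    (w, u, k) ∈ G.levelEdge z t ↔ w = z ∧ u = t ∧ k < G.m := by
  simp only [levelEdge, Finset.mem_image, Finset.mem_range, Prod.mk.injEq]
  constructor
  · rintro ⟨k', h, rfl, rfl, rfl⟩; exact ⟨rfl, rfl, h⟩
  · rintro ⟨rfl, rfl, h⟩; exact ⟨k, h, rfl, rfl, rfl⟩

theorem mem_linkEdge {z w : ι × κ} {t u k : ℕ} :
    (w, u, k) ∈ G.linkEdge z t ↔
      w = z ∧ ((u = t + 1 ∧ k = 0) ∨ (u = t ∧ 0 < k ∧ k < G.m)) := by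
  simp only [linkEdge, Finset.mem_insert, Finset.mem_image, Finset.mem_range, Prod.mk.injEq]
  constructor
  · rintro (⟨rfl, rfl, rfl⟩ | ⟨k', h, rfl, rfl, rfl⟩)
    · simp
    · exact ⟨rfl, .inr ⟨rfl, by omega, by omega⟩⟩
  · rintro ⟨rfl, ⟨rfl, rfl⟩ | ⟨rfl, h, h'⟩⟩
    · simp
    · exact .inr ⟨k - 1, by omega, rfl, rfl, by omega⟩

theorem mem_partEdge {b : ι} {E : Finset κ} {w : ι × κ} {u k : ℕ} [DecidableEq (Finset κ)] :
    (w, u, k) ∈ G.partEdge b E ↔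
      w.1 = b ∧ w.2 ∈ E ∧ u = (G.edges w).idxOf E ∧ k = 0 := by
  simp only [partEdge, Finset.mem_image, Prod.mk.injEq]
  constructor
  · rintro ⟨q, hq, rfl, rfl, rfl⟩; exact ⟨rfl, hq, by congr!, rfl⟩
  · rintro ⟨rfl, h, rfl, rfl⟩; exact ⟨w.2, h, rfl, by congr!, rfl⟩

theorem mem_groupEdge {z w : ι × κ} {u k : ℕ} :
    (w, u, k) ∈ G.groupEdge z ↔ w ∈ G.grp z ∧ u = G.len w ∧ k = 0 := by
  simp only [groupEdge, Finset.mem_image, Prod.mk.injEq]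
  constructor
  · rintro ⟨w', h, rfl, rfl, rfl⟩; exact ⟨h, rfl, rfl⟩
  · rintro ⟨h, rfl, rfl⟩; exact ⟨w, h, rfl, rfl, rfl⟩

theorem idxOf_lt_len [DecidableEq (Finset κ)] {z : ι × κ} {E : Finset κ} (h : E ∈ G.edges z) :
    (G.edges z).idxOf E < G.len z := List.idxOf_lt_length_of_mem h

/-- The formula attached to an edge is unique. -/
theorem EdgeForm.unique (hm : 1 < G.m) (hG : G.IsGrouped) {e : Finset ((ι × κ) × ℕ × ℕ)}
    {A A' : PForm V} (h : G.EdgeForm e A) (h' : G.EdgeForm e A') : A = A' := by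
  classical
  -- The kinds of edges are told apart by their vertices. Level and link edges contain a vertex with
  -- last coordinate 1 (here `1 < m` matters), part and group edges do not. A level edge has its
  -- vertex 0 on the same level, a link edge on the next one. Group edges sit on level `len`, part
  -- edges strictly below it.
  have part_ne : ∀ {b : ι} {E : Finset κ} {z t}, E.card = G.m →
      ¬ ((z, t, 1) ∈ G.partEdge b E) := by
    intro b E z t hE h
    have := (mem_partEdge.1 h).2.2.2
    omega
  have group_ne : ∀ {z w t}, ¬ ((z, t, 1) ∈ G.groupEdge w) := by
    intro z w t h
    have := (mem_groupEdge.1 h).2.2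
    omega
  have level_mem : ∀ z t, (z, t, 1) ∈ G.levelEdge z t := fun z t => mem_levelEdge.2 ⟨rfl, rfl, hm⟩
  have level_mem0 : ∀ z t, (z, t, 0) ∈ G.levelEdge z t := fun z t =>
    mem_levelEdge.2 ⟨rfl, rfl, by omega⟩
  have link_mem : ∀ z t, (z, t, 1) ∈ G.linkEdge z t := fun z t =>
    mem_linkEdge.2 ⟨rfl, .inr ⟨rfl, by omega, hm⟩⟩
  have level_link : ∀ z t w u, G.levelEdge z t ≠ G.linkEdge w u := by
    intro z t w u h
    have h1 := mem_linkEdge.1 (h ▸ level_mem z t)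
    have h2 := mem_linkEdge.1 (h ▸ level_mem0 z t)
    omega
  have part_mem : ∀ {b : ι} {E : Finset κ}, E.card = G.m → ∃ q ∈ E,
      ((b, q), (G.edges (b, q)).idxOf E, 0) ∈ G.partEdge b E := by
    intro b E hE
    obtain ⟨q, hq⟩ := Finset.card_pos.1 (by omega : 0 < E.card)
    exact ⟨q, hq, mem_partEdge.2 ⟨rfl, hq, rfl, rfl⟩⟩
  have group_part : ∀ {z b E}, E ⊆ G.M b → E.card = G.m → G.groupEdge z ≠ G.partEdge b E := by
    intro z b E hEM hE h
    obtain ⟨q, hq, hqE⟩ := part_mem (b := b) hE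
    have h1 := (mem_groupEdge.1 (h ▸ hqE)).2.1
    have h2 := idxOf_lt_len (z := (b, q)) (mem_edges.2 ⟨⟨hEM, hE⟩, hq⟩)
    omega
  generalize hee : e = e' at h'
  cases h with
  | @level z t hz ht =>
    cases h' with
    | @level w u hw hu =>
      obtain ⟨rfl, rfl, _⟩ := mem_levelEdge.1 (hee ▸ level_mem z t)
      rfl
    | link => exact absurd hee (level_link _ _ _ _)
    | part _ _ h => exact absurd (hee ▸ level_mem z t) (part_ne h)
    | group => exact absurd (hee ▸ level_mem z t) group_ne
  | @link z t hz ht =>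
    cases h' with
    | level => exact absurd hee.symm (level_link _ _ _ _)
    | @link w u hw hu =>
      obtain ⟨rfl, ⟨_, h⟩ | ⟨rfl, _⟩⟩ := mem_linkEdge.1 (hee ▸ link_mem z t)
      · omega
      · rfl
    | part _ _ h => exact absurd (hee ▸ link_mem z t) (part_ne h)
    | group => exact absurd (hee ▸ link_mem z t) group_ne
  | @part b E hb hEM hE =>
    cases h' with
    | @level w u => exact absurd (hee ▸ level_mem w u) (part_ne hE)
    | @link w u => exact absurd (hee ▸ link_mem w u) (part_ne hE)
    | @part b' E' hb' hEM' hE' =>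
      obtain ⟨q, hq, hqE⟩ := part_mem (b := b) hE
      obtain ⟨h, -⟩ := mem_partEdge.1 (hee ▸ hqE)
      simp only at h
      subst h
      have : E = E' := by
        have key : ∀ {E E' : Finset κ}, G.partEdge b E = G.partEdge b E' → E ⊆ E' :=
          fun {E E'} h q hq => (mem_partEdge.1 (h ▸ mem_partEdge.2 ⟨rfl, hq, rfl, rfl⟩ :
            ((b, q), (G.edges (b, q)).idxOf E, 0) ∈ G.partEdge b E')).2.1
        exact subset_antisymm (key hee) (key hee.symm)
      subst this
      rfl
    | group => exact absurd hee.symm (group_part hEM hE)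
  | @group z hz hzt =>
    cases h' with
    | @level w u => exact absurd (hee ▸ level_mem w u) group_ne
    | @link w u => exact absurd (hee ▸ link_mem w u) group_ne
    | part _ hEM hE => exact absurd hee (group_part hEM hE)
    | @group w hw hwt =>
      have hz' : (z, G.len z, 0) ∈ G.groupEdge z := mem_groupEdge.2 ⟨hG.mem z hz hzt, rfl, rfl⟩
      rw [hee] at hz'
      -- Different points of a group give the same edge; uniqueness survives because they share the
      -- formula `Q`.
      rw [(hG.compat w hw hwt z (mem_groupEdge.1 hz').1).2.2]

theorem edgeVar_eq (hm : 1 < G.m) (hG : G.IsGrouped) {e : Finset ((ι × κ) × ℕ × ℕ)} {A : PForm V}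
    (h : G.EdgeForm e A) : G.edgeVar e = A := by
  have h' : ∃ A, G.EdgeForm e A := ⟨A, h⟩
  rw [edgeVar, dif_pos h']
  exact h'.choose_spec.unique hm hG h

theorem length_inc_le (v : (ι × κ) × ℕ × ℕ) : (G.inc v).length ≤ 3 := by
  have : ∀ z t, (G.linksBefore z t).length ≤ 1 := by
    rintro z (_ | t) <;> simp [linksBefore]
  have := this v.1 v.2.1
  rw [inc]
  split_ifs <;> simp <;> omega

theorem getD_edges {z : ι × κ} {t : ℕ} (h : t < G.len z) :
    (G.edges z).getD t ∅ = (G.edges z)[t]'h := by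
  simp [List.getD_eq_getElem?_getD, List.getElem?_eq_getElem (show t < (G.edges z).length from h)]

/-- The edges at a vertex are edges through this vertex. -/
theorem of_mem_inc (hm : 1 < G.m) (hG : G.IsGrouped) {v : (ι × κ) × ℕ × ℕ} (hv : v ∈ G.vertices)
    {e : Finset ((ι × κ) × ℕ × ℕ)} (he : e ∈ G.inc v) :
    v ∈ e ∧ e ⊆ G.vertices ∧ e.card = G.m := by
  classical
  obtain ⟨z, t, k⟩ := v
  obtain ⟨hz, hv⟩ := mem_vertices.1 hv
  simp only at hz hv
  have level : t < G.len z → k < G.m → (z, t, k) ∈ G.levelEdge z t ∧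
      G.levelEdge z t ⊆ G.vertices ∧ (G.levelEdge z t).card = G.m := by
    intro ht hk
    refine ⟨mem_levelEdge.2 ⟨rfl, rfl, hk⟩, ?_, ?_⟩
    · rintro ⟨w, u, l⟩ hl
      obtain ⟨rfl, rfl, hl'⟩ := mem_levelEdge.1 hl
      exact mem_vertices.2 ⟨hz, .inl ⟨ht, hl'⟩⟩
    · rw [levelEdge, Finset.card_image_of_injective _ (fun a b h => by simpa using h),
        Finset.card_range]
  have link : ∀ t < G.len z, G.linkEdge z t ⊆ G.vertices ∧ (G.linkEdge z t).card = G.m := by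
    intro t ht
    constructor
    · rintro ⟨w, u, l⟩ hl
      obtain ⟨rfl, ⟨rfl, rfl⟩ | ⟨rfl, _, hl'⟩⟩ := mem_linkEdge.1 hl
      · exact mem_vertices.2 ⟨hz, (Nat.lt_or_eq_of_le (Nat.succ_le_of_lt ht)).imp
          (fun h => ⟨h, Nat.zero_lt_of_lt hm⟩) fun h => ⟨h, rfl⟩⟩
      · exact mem_vertices.2 ⟨hz, .inl ⟨ht, hl'⟩⟩
    · rw [linkEdge, Finset.card_insert_of_notMem (by simp),
        Finset.card_image_of_injective _ (fun a b h => by simpa using h), Finset.card_range]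
      omega
  have links : k = 0 → t ≤ G.len z → e ∈ G.linksBefore z t →
      (z, t, k) ∈ e ∧ e ⊆ G.vertices ∧ e.card = G.m := by
    rintro rfl ht h
    cases t with
    | zero => simp [linksBefore] at h
    | succ t =>
      simp only [linksBefore, List.mem_singleton] at h
      subst h
      exact ⟨mem_linkEdge.2 ⟨rfl, .inl ⟨rfl, rfl⟩⟩, link t (by omega)⟩
  simp only [inc] at he
  split_ifs at he with h₁ h₂ h₂
  · subst h₂
    simp only [List.mem_cons, List.mem_append, List.not_mem_nil, or_false] at he
    rcases he with rfl | he | rfl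
    · exact level h₁ (by omega)
    · exact links rfl h₁.le he
    · rw [getD_edges h₁]
      set E := (G.edges z)[t]'h₁ with hE
      have hEm : E ∈ G.edges z := List.getElem_mem h₁
      obtain ⟨⟨hEM, hEc⟩, hzE⟩ := mem_edges.1 hEm
      refine ⟨mem_partEdge.2 ⟨rfl, hzE, ?_, rfl⟩, ?_, ?_⟩
      · exact ((nodup_edges z).idxOf_getElem t h₁).symm
      · rintro ⟨w, u, l⟩ hl
        obtain ⟨hw, hwE, rfl, rfl⟩ := mem_partEdge.1 hl
        have hw' := hEM hwE
        rw [← hw] at hw'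
        refine mem_vertices.2 ⟨mem_points.2 ⟨hw ▸ (mem_points.1 hz).1, hw'⟩, .inl ⟨?_, by
          simp only; omega⟩⟩
        exact idxOf_lt_len (mem_edges.2 ⟨⟨hw ▸ hEM, hEc⟩, hwE⟩)
      · rw [partEdge, Finset.card_image_of_injective _ (fun a b h => by simp at h; exact h.1), hEc]
  · simp only [List.mem_cons, List.not_mem_nil, or_false] at he
    rcases he with rfl | rfl
    · exact level h₁ (by omega)
    · exact ⟨mem_linkEdge.2 ⟨rfl, .inr ⟨rfl, by omega, by omega⟩⟩, link t h₁⟩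
  · simp only [List.append_nil] at he
    exact links (by omega) (by omega) he
  · simp only [List.mem_cons, List.mem_append, List.not_mem_nil, or_false] at he
    rcases he with he | rfl
    · exact links (by omega) (by omega) he
    · refine ⟨mem_groupEdge.2 ⟨hG.mem z hz h₂, by omega, by omega⟩, ?_, ?_⟩
      · rintro ⟨w, u, l⟩ hl
        obtain ⟨hw, rfl, rfl⟩ := mem_groupEdge.1 hl
        exact mem_vertices.2 ⟨hG.subset z hz h₂ hw, .inr ⟨rfl, rfl⟩⟩
      · rw [groupEdge, Finset.card_image_of_injective _ (fun a b h => by simp at h; exact h.1),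
          hG.card z hz h₂]

/-- The edges that are not listed at a vertex on them have the formula FALSE. -/
theorem mem_inc_or (hG : G.IsGrouped) {v : (ι × κ) × ℕ × ℕ}
    {e : Finset ((ι × κ) × ℕ × ℕ)} (hve : v ∈ e) : e ∈ G.inc v ∨ G.edgeVar e = fls := by
  classical
  by_cases h : ∃ A, G.EdgeForm e A
  swap
  · right; rw [edgeVar, dif_neg h]
  left
  obtain ⟨A, hA⟩ := h
  obtain ⟨z, t, k⟩ := v
  cases hA with
  | level hz ht =>
    obtain ⟨rfl, rfl, hk⟩ := mem_levelEdge.1 hve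
    simp only [inc, if_pos ht]
    split_ifs <;> simp
  | link hz ht =>
    obtain ⟨rfl, ⟨rfl, rfl⟩ | ⟨rfl, hk, _⟩⟩ := mem_linkEdge.1 hve
    · simp only [inc]
      split_ifs <;> simp [linksBefore]
    · simp only [inc, if_pos ht, if_neg hk.ne']
      simp
  | @part b E hb hEM hE =>
    obtain ⟨rfl, hzE, rfl, rfl⟩ := mem_partEdge.1 hve
    have hmem : E ∈ G.edges z := mem_edges.2 ⟨⟨hEM, hE⟩, hzE⟩
    have hlt := idxOf_lt_len hmem
    simp only [inc, if_pos hlt, if_true]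
    rw [getD_edges hlt, List.getElem_idxOf]
    simp
  | @group w hw hwt =>
    obtain ⟨hz, rfl, rfl⟩ := mem_groupEdge.1 hve
    obtain ⟨h₁, h₂, _⟩ := hG.compat w hw hwt z hz
    simp only [inc, lt_irrefl, if_false, if_neg h₂]
    simp [groupEdge, h₁]

end ChainGadget

theorem Proves.or_symm : ∃ c : ℕ, ∀ {V : Type} {Ax K : Set (PForm V)} {D s δ n : ℕ}
    {A B : PForm V}, δ + c ≤ D → Within s δ A → Within s δ B →
    Proves Ax D K (n * (s + 1)) {or [A, B]} → Proves Ax D K ((n + c) * (s + 1)) {or [B, A]} := by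
  obtain ⟨c, hc⟩ := taut (k := 2) [or [var 0, var 1]] (or [var 1, var 0])
    (by intro v; simp [eval, evalList]; tauto)
  exact ⟨c, fun {V Ax K D s δ n A B} hD hA hB h =>
    (hc (δ := δ) ![A, B] hD (.forall₂ hA hB) (.cons h .nil)).cost (by simp)⟩

-- Refuting a chain gadget

namespace ChainGadget

/-- `I z` says that the point satisfies its own part of the condition, so that `Q z` is equivalent
to `J ∧ I z`. The chain facts are exactly the covering and exclusion conditions at the vertices. In
the cost, the first summand is the number of vertices times the local cost, in which `R` bounds the
chain length; the second comes from the balanced refutation of the disjuncts. -/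
theorem refute (m : ℕ) (hm : 1 < m) : ∃ c : ℕ, ∀ {V ι κ : Type} (G : ChainGadget V ι κ)
    (I : ι × κ → PForm V) {K : Set (PForm V)} {D s δ n h R : ℕ}, G.m = m → G.IsGrouped →
    ¬ m ∣ G.vertices.card → 1 ≤ s → 1 ≤ δ → δ + c ≤ D →
    (∀ z ∈ G.points, Within s δ (or (G.forms z)) ∧ Within s δ (G.J z.1) ∧ Within s δ (I z) ∧
      Within s δ (G.Q z)) →
    (∀ z ∈ G.points, ∀ E ∈ G.edges z,
      Proves (countingAxioms V m) D K (n * (s + 1)) {or [neg (G.θ z.1 E), I z]}) →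
    (∀ z ∈ G.points, ∀ E ∈ G.edges z, ∀ F ∈ G.edges z, E ≠ F →
      Proves (countingAxioms V m) D K (n * (s + 1)) {or [neg (G.θ z.1 E), neg (G.θ z.1 F)]}) →
    (∀ z ∈ G.points,
      Proves (countingAxioms V m) D K (n * (s + 1)) {or [neg (I z), or (G.forms z)]}) →
    (∀ z ∈ G.points, Proves (countingAxioms V m) D K (n * (s + 1)) {or [neg (G.Q z), G.J z.1]}) →
    (∀ z ∈ G.points, Proves (countingAxioms V m) D K (n * (s + 1)) {or [neg (G.Q z), I z]}) →
    (∀ z ∈ G.points, Proves (countingAxioms V m) D K (n * (s + 1))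
      {or [neg (G.J z.1), or [neg (I z), G.Q z]]}) →
    (∀ z ∈ G.points, G.triv z → Proves (countingAxioms V m) D K (n * (s + 1)) {G.Q z}) →
    (∀ z ∈ G.points, G.len z ≤ R) → c * G.vertices.card ≤ 2 ^ h →
    Proves (countingAxioms V m) D K
      ((c * G.vertices.card * ((R + 1) * (n + 1)) + c * (h + 1) * 2 ^ h) * (s + 1)) {fls} := by
  classical
  obtain ⟨c₁, chain⟩ := chainFacts
  obtain ⟨c₂, counting⟩ := Proves.counting m 3
  obtain ⟨c₃, or_symm⟩ := Proves.or_symm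
  refine ⟨7 * c₂ * (8 * (c₁ + 1) + c₃ + c₂) + c₁ + 7 * c₂ + c₃ + 10, ?_⟩
  intro V ι κ G I K D s δ n h R hGm hG hcard hs hδ hD hW hθI hθθ hIθ hQJ hQI hJIQ htriv hR hh
  have hGm1 : 1 < G.m := hGm ▸ hm
  -- the local facts
  have facts : ∀ z ∈ G.points, _ := fun z hz =>
    chain (Ax := countingAxioms V m) (K := K) (D := D) (s := s) (δ := δ) (n := n) (T := G.forms z)
      (J := G.J z.1) (I := I z) (Q := G.Q z) (by omega) (hW z hz).1 (hW z hz).2.1 (hW z hz).2.2.1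
      (hW z hz).2.2.2
      (by
        intro A hA
        obtain ⟨E, hE, rfl⟩ := List.mem_map.1 hA
        exact hθI z hz E hE)
      (by
        rw [forms, List.pairwise_map]
        refine (List.pairwise_iff_forall_sublist.2 fun {E F} hEF => ?_)
        have hmem := hEF.subset
        have hne : E ≠ F := by
          have := hEF.nodup (nodup_edges z)
          simpa using this
        exact hθθ z hz E (hmem (by simp)) F (hmem (by simp)) hne)
      (hIθ z hz) (hQJ z hz) (hQI z hz) (hJIQ z hz)
  have hlen : ∀ z, (G.forms z).length = G.len z := fun z => by simp [forms]
  have hform : ∀ z t (h : t < G.len z), (G.forms z)[t]'(by rw [hlen]; exact h) =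
      G.θ z.1 ((G.edges z).getD t ∅) := fun z t h => by
    rw [getD_edges h]; simp [forms]
  -- sizes
  have hW' : ∀ {e A}, G.EdgeForm e A → Within (2 * s + 5) (δ + 4) A := by
    intro e A hA
    have hpre : ∀ z ∈ G.points, ∀ t, Within (2 * s + 4) (δ + 3)
        (prefixConj (G.J z.1) (G.forms z) t) := fun z hz t =>
      (hW z hz).2.1.conj_pair ((hW z hz).1.of_subset (List.take_subset _ _))
    cases hA with
    | level hz _ => exact (hpre _ hz _).neg
    | link hz _ => exact (hpre _ hz _).mono (by omega) (by omega)
    | @part b E hb hEM hE =>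
      obtain ⟨q, hq⟩ := Finset.card_pos.1 (by omega : 0 < E.card)
      have hz : (b, q) ∈ G.points := mem_points.2 ⟨hb, hEM hq⟩
      have hθ : G.θ b E ∈ G.forms (b, q) :=
        List.mem_map.2 ⟨E, mem_edges.2 ⟨⟨hEM, hE⟩, hq⟩, rfl⟩
      exact ((hW _ hz).2.1.conj_pair ((hW _ hz).1.of_mem hθ)).mono (by omega) (by omega)
    | group hz _ => exact (hW _ hz).2.2.2.neg.mono (by omega) (by omega)
  have hWe : ∀ e, Within (2 * s + 5) (δ + 4) (G.edgeVar e) := by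
    intro e
    by_cases he : ∃ A, G.EdgeForm e A
    · obtain ⟨A, hA⟩ := he
      rw [edgeVar_eq hGm1 hG hA]
      exact hW' hA
    · rw [edgeVar, dif_neg he]
      exact fls_within.mono (by omega) (by omega)
  obtain ⟨n', hn'⟩ : ∃ n', n' = 2 * (R + 4) * (n + c₁) := ⟨_, rfl⟩
  have cost : ∀ z ∈ G.points, 2 * ((G.forms z).length + 4) * (n + c₁) * (s + 1) ≤
      n' * (2 * s + 6 + 1) := by
    intro z hz
    rw [hn', hlen]
    have := hR z hz
    gcongr
    omega
  have cost' : ∀ z ∈ G.points, 2 * ((G.forms z).length + 4) * (n + c₁) * (s + 1) ≤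
      (n' + c₃) * (2 * s + 6 + 1) := fun z hz =>
    (cost z hz).trans (Nat.mul_le_mul_right _ (by omega))
  have level_eq : ∀ z ∈ G.points, ∀ t < G.len z, G.edgeVar (G.levelEdge z t) =
      neg (prefixConj (G.J z.1) (G.forms z) (t + 1)) := fun z hz t ht =>
    edgeVar_eq hGm1 hG (.level hz ht)
  have link_eq : ∀ z ∈ G.points, ∀ t < G.len z, G.edgeVar (G.linkEdge z t) =
      prefixConj (G.J z.1) (G.forms z) (t + 1) := fun z hz t ht =>
    edgeVar_eq hGm1 hG (.link hz ht)
  have part_eq : ∀ z ∈ G.points, ∀ t (ht : t < G.len z),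
      G.edgeVar (G.partEdge z.1 ((G.edges z).getD t ∅)) =
      conj [G.J z.1, (G.forms z)[t]'(by rw [hlen]; exact ht)] := fun z hz t ht => by
    have hmem : (G.edges z).getD t ∅ ∈ G.edges z := by
      rw [getD_edges ht]; exact List.getElem_mem ht
    obtain ⟨⟨h₁, h₂⟩, _⟩ := mem_edges.1 hmem
    rw [hform z t ht, edgeVar_eq hGm1 hG (.part (mem_points.1 hz).1 h₁ h₂)]
  have group_eq : ∀ z ∈ G.points, ¬ G.triv z → G.edgeVar (G.groupEdge z) = neg (G.Q z) :=
    fun z hz ht => edgeVar_eq hGm1 hG (.group hz ht)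
  -- The formulas of edges fit into size `2 * s + 5` and depth `δ + 4`; the extra unit leaves room
  -- for their negations in the exclusion conditions.
  have main := counting (K := K) (D := D) (s := 2 * s + 6) (δ := δ + 5) (n := n' + c₃) (h := h)
    G.vertices G.edgeVar G.inc hcard (by omega) (by omega) (by omega)
    (fun e => (hWe e).mono (by omega) (by omega)) length_inc_le
    (fun v hv e he => hGm ▸ of_mem_inc hGm1 hG hv he)
    (fun e _ _ v hv => mem_inc_or hG hv) ?_ ?_ ?_
  · refine main.cost ?_
    obtain ⟨a, ha⟩ : ∃ a, a = 8 * (c₁ + 1) + c₃ + c₂ := ⟨_, rfl⟩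
    obtain ⟨c, hc⟩ : ∃ c, c = 7 * c₂ * a + c₁ + 7 * c₂ + c₃ + 10 := ⟨_, rfl⟩
    rw [← ha, ← hc]
    have e₁ : n' + c₃ + c₂ ≤ (R + 1) * (n + 1) * a := by
      have h1 : n' ≤ 8 * (R + 1) * ((n + 1) * (c₁ + 1)) := by
        rw [hn']
        refine Nat.mul_le_mul (by omega) ?_
        ring_nf; omega
      have h2 : c₃ + c₂ ≤ (R + 1) * (n + 1) * (c₃ + c₂) := Nat.le_mul_of_pos_left _ (by positivity)
      calc _ ≤ 8 * (R + 1) * ((n + 1) * (c₁ + 1)) + (R + 1) * (n + 1) * (c₃ + c₂) := by omega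
        _ = _ := by rw [ha]; ring
    have e₂ : 2 * s + 6 + 1 ≤ 7 * (s + 1) := by omega
    calc _ ≤ (c₂ * G.vertices.card * ((R + 1) * (n + 1) * a) + c₂ * (h + 1) * 2 ^ h) *
          (7 * (s + 1)) := by gcongr
      _ = (7 * c₂ * a * G.vertices.card * ((R + 1) * (n + 1)) + 7 * c₂ * (h + 1) * 2 ^ h) *
          (s + 1) := by ring
      _ ≤ _ := by gcongr <;> omega
  · -- every vertex is covered
    rintro ⟨z, t, k⟩ hv
    obtain ⟨hz, hv⟩ := mem_vertices.1 hv
    obtain ⟨F, F'⟩ := facts z hz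
    simp only at hz hv
    simp only [inc]
    split_ifs with h₁ h₂ h₂
    -- Vertex 0 of level `t`: no part up to index `t` is used (level edge), an earlier one is
    -- (previous link, absent for `t = 0`), or the one of index `t` is (part edge).
    · cases t with
      | zero =>
        simp only [linksBefore, List.nil_append, List.map_cons, List.map_nil]
        rw [level_eq z hz 0 h₁, part_eq z hz 0 h₁]
        exact (F.first (by rw [hlen]; exact h₁)).cost (cost' z hz)
      | succ t =>
        simp only [linksBefore, List.cons_append, List.nil_append, List.map_cons, List.map_nil]
        rw [level_eq z hz _ h₁, part_eq z hz _ h₁, link_eq z hz t (by omega)]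
        exact (F.step (t + 1) (by rw [hlen]; exact h₁)).cost (cost' z hz)
    · simp only [List.map_cons, List.map_nil]
      rw [level_eq z hz t h₁, link_eq z hz t h₁]
      exact (F.em (t + 1)).cost (cost' z hz)
    -- The last vertex of a trivial point has no group edge. As `Q z` is provable, so is the formula
    -- of the last link. If no part contains the point, `I z → ⋁∅` yields the empty disjunction,
    -- which is the required covering.
    · obtain rfl : t = G.len z := by omega
      cases ht : G.len z with
      | zero =>
        simp only [linksBefore, List.nil_append, List.map_nil]
        exact ((F' (htriv z hz h₂)).last_nil (List.length_eq_zero_iff.1 (by rw [hlen, ht]))).cost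
          (cost' z hz)
      | succ t =>
        simp only [linksBefore, List.append_nil, List.map_cons, List.map_nil]
        rw [link_eq z hz t (by omega), ← ht, ← hlen]
        exact (F' (htriv z hz h₂)).last.cost (cost' z hz)
    · obtain rfl : t = G.len z := by omega
      cases ht : G.len z with
      | zero =>
        simp only [linksBefore, List.nil_append, List.map_cons, List.map_nil]
        rw [group_eq z hz h₂]
        exact (F.last_nil (List.length_eq_zero_iff.1 (by rw [hlen, ht]))).cost (cost' z hz)
      | succ t =>
        simp only [linksBefore, List.cons_append, List.nil_append, List.map_cons, List.map_nil]
        rw [link_eq z hz t (by omega), group_eq z hz h₂, ← ht, ← hlen]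
        exact F.last.cost (cost' z hz)
  · -- the edges at a vertex are mutually exclusive
    rintro ⟨z, t, k⟩ hv e he f hf hef
    obtain ⟨hz, hv⟩ := mem_vertices.1 hv
    obtain ⟨F, -⟩ := facts z hz
    simp only at hz hv
    -- The chain facts state each exclusion in one order only, so a symmetric relation is checked on
    -- the list of edges and `or_symm` supplies the other order.
    let R : Finset ((ι × κ) × ℕ × ℕ) → Finset ((ι × κ) × ℕ × ℕ) → Prop := fun e f =>
      Proves (countingAxioms V m) D K (n' * (2 * s + 6 + 1))
          {or [neg (G.edgeVar e), neg (G.edgeVar f)]} ∨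
        Proves (countingAxioms V m) D K (n' * (2 * s + 6 + 1))
          {or [neg (G.edgeVar f), neg (G.edgeVar e)]}
    suffices h : (G.inc (z, t, k)).Pairwise R by
      have hR : Std.Symm R := ⟨fun _ _ h => h.symm⟩
      rcases h.forall he hf hef with h | h
      · exact h.cost (Nat.mul_le_mul_right _ (by omega))
      · exact or_symm (δ := δ + 5) (by omega) (hWe f).neg (hWe e).neg h
    simp only [inc]
    split_ifs with h₁ h₂ h₂
    · have r₁ : R (G.levelEdge z t) (G.partEdge z.1 ((G.edges z).getD t ∅)) := by
        left
        rw [level_eq z hz t h₁, part_eq z hz t h₁]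
        exact (F.mem t (by rw [hlen]; exact h₁)).cost (cost z hz)
      cases t with
      | zero => simpa [linksBefore] using r₁
      | succ t =>
        have r₂ : R (G.levelEdge z (t + 1)) (G.linkEdge z t) := by
          left
          rw [level_eq z hz _ h₁, link_eq z hz t (by omega)]
          exact (F.mono _ (by rw [hlen]; exact h₁)).cost (cost z hz)
        have r₃ : R (G.linkEdge z t) (G.partEdge z.1 ((G.edges z).getD (t + 1) ∅)) := by
          left
          rw [link_eq z hz t (by omega), part_eq z hz _ h₁]
          exact (F.disjoint _ (by rw [hlen]; exact h₁)).cost (cost z hz)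
        simp only [linksBefore, List.cons_append, List.nil_append, List.pairwise_cons,
          List.mem_cons, List.not_mem_nil, or_false, forall_eq_or_imp, forall_eq,
          List.Pairwise.nil, and_true, false_imp_iff, implies_true]
        exact ⟨⟨r₂, r₁⟩, r₃⟩
    · have r : R (G.levelEdge z t) (G.linkEdge z t) := by
        left
        rw [level_eq z hz t h₁, link_eq z hz t h₁]
        exact (F.neg_em _).cost (cost z hz)
      simpa using r
    · cases t <;> simp [linksBefore]
    · obtain rfl : t = G.len z := by omega
      cases ht : G.len z with
      | zero => simp [linksBefore]
      | succ t =>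
        have r : R (G.linkEdge z t) (G.groupEdge z) := by
          left
          rw [link_eq z hz t (by omega), group_eq z hz h₂, ← ht, ← hlen]
          exact F.last_disjoint.cost (cost z hz)
        simpa [linksBefore] using r
  · refine le_trans (Nat.mul_le_mul_right _ ?_) hh
    have := Nat.le_mul_of_pos_left c₂ (show 0 < 7 by omega)
    omega

end ChainGadget

/-! ### Counting monomials modulo `m` -/

/-- A set whose fibres have sizes divisible by `m` splits into groups of size `m` inside fibres. -/
theorem exists_groups {ζ γ : Type} {m : ℕ} (hm : 0 < m) (κ : ζ → γ) [DecidableEq γ] (S : Finset ζ)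
    (hS : ∀ c, m ∣ (S.filter fun z => κ z = c).card) :
    ∃ grp : ζ → Finset ζ, ∀ z ∈ S, z ∈ grp z ∧ grp z ⊆ S ∧ (grp z).card = m ∧
      ∀ w ∈ grp z, grp w = grp z ∧ κ w = κ z := by
  classical
  induction S using Finset.strongInduction with
  | H S ih =>
    obtain rfl | ⟨z₀, hz₀⟩ := S.eq_empty_or_nonempty
    · exact ⟨fun _ => ∅, by simp⟩
    have hle : m ≤ (S.filter fun z => κ z = κ z₀).card :=
      Nat.le_of_dvd (Finset.card_pos.2 ⟨z₀, by simp [hz₀]⟩) (hS _)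
    obtain ⟨g, hg, hgm⟩ := Finset.exists_subset_card_eq hle
    have hgS : g ⊆ S := hg.trans (Finset.filter_subset _ _)
    have hgκ : ∀ z ∈ g, κ z = κ z₀ := fun z hz => (Finset.mem_filter.1 (hg hz)).2
    have hgne : g.Nonempty := Finset.card_pos.1 (hgm ▸ hm)
    -- Removing `m` points of a single fibre keeps all fibre sizes divisible by `m`.
    obtain ⟨grp, hgrp⟩ := ih (S \ g) (Finset.sdiff_ssubset hgS hgne) fun c => by
      by_cases hc : c = κ z₀
      · subst hc
        have : ((S \ g).filter fun z => κ z = κ z₀) = (S.filter fun z => κ z = κ z₀) \ g := by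
          ext z; simp only [Finset.mem_filter, Finset.mem_sdiff]; tauto
        rw [this, Finset.card_sdiff_of_subset hg, hgm]
        exact Nat.dvd_sub (hS _) dvd_rfl
      · have : ((S \ g).filter fun z => κ z = c) = S.filter fun z => κ z = c := by
          ext z
          simp only [Finset.mem_filter, Finset.mem_sdiff]
          exact ⟨fun h => ⟨h.1.1, h.2⟩, fun h => ⟨⟨h.1, fun h' => hc (by rw [← h.2, hgκ z h'])⟩, h.2⟩⟩
        rw [this]; exact hS c
    refine ⟨fun z => if z ∈ g then g else grp z, fun z hz => ?_⟩
    by_cases hzg : z ∈ g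
    · simp only [if_pos hzg]
      exact ⟨hzg, hgS, hgm, fun w hw => ⟨if_pos hw, by rw [hgκ w hw, hgκ z hzg]⟩⟩
    · simp only [if_neg hzg]
      obtain ⟨h₁, h₂, h₃, h₄⟩ := hgrp z (Finset.mem_sdiff.2 ⟨hz, hzg⟩)
      refine ⟨h₁, h₂.trans Finset.sdiff_subset, h₃, fun w hw => ?_⟩
      rw [if_neg (Finset.mem_sdiff.1 (h₂ hw)).2]
      exact h₄ w hw

/-- If for every `A ⊆ W` the number of points below `A` is `1` modulo `m`, then the number of points
at `A ≠ ∅` is `0` modulo `m`. -/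
theorem card_fiber_eq_zero {ζ α R : Type} [DecidableEq α] [Ring R] (κ : ζ → Finset α)
    (S : Finset ζ) (W : Finset α)
    (h : ∀ A ⊆ W, ((S.filter fun z => κ z ⊆ A).card : R) = 1) (A : Finset α) (hA : A ⊆ W)
    (hne : A ≠ ∅) : ((S.filter fun z => κ z = A).card : R) = 0 := by
  induction A using Finset.strongInduction with
  | H A ih =>
    have h0 : ((S.filter fun z => κ z = ∅).card : R) = 1 := by
      have := h ∅ (Finset.empty_subset _)
      simpa only [Finset.subset_empty] using this
    have h1 : (S.filter fun z => κ z ⊆ A).card =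
        ∑ A' ∈ A.powerset, (S.filter fun z => κ z = A').card := by
      rw [Finset.card_eq_sum_card_fiberwise (f := κ) (t := A.powerset)
        (fun z hz => by simpa using (Finset.mem_filter.1 hz).2)]
      refine Finset.sum_congr rfl fun A' hA' => ?_
      rw [Finset.filter_filter]
      congr 1
      ext z
      simp only [Finset.mem_filter, and_congr_right_iff, and_iff_right_iff_imp]
      rintro - rfl
      exact Finset.mem_powerset.1 hA'
    have h2 := h A hA
    have hmem : A ∈ A.powerset.erase ∅ := by simp [hne]
    -- In the sum over the subsets of `A`, the empty set contributes 1, the proper nonempty subsets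
    -- vanish by induction, and the total is 1; so the term of `A` itself is 0.
    rw [h1, ← Finset.add_sum_erase _ _ (Finset.empty_mem_powerset A),
      ← Finset.add_sum_erase _ _ hmem, Nat.cast_add, Nat.cast_add, Nat.cast_sum, h0,
      Finset.sum_eq_zero, add_zero] at h2
    · simpa using h2
    · intro A' hA'
      simp only [Finset.mem_erase, Finset.mem_powerset] at hA'
      exact ih A' (Finset.ssubset_iff_subset_ne.2 ⟨hA'.2.2, hA'.1⟩) (hA'.2.2.trans hA) hA'.2.1

-- Polynomials at 0/1 points

section Polynomials

variable {n m : ℕ}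

/-- The characteristic function of a set of variables. -/
def boolPoint (m : ℕ) {n : ℕ} (A : Finset (Fin n)) : Fin n → ZMod m := fun j => if j ∈ A then 1 else 0

theorem prod_boolPoint (A : Finset (Fin n)) (t : Fin n →₀ ℕ) :
    (∏ i ∈ t.support, boolPoint m A i ^ t i) = if t.support ⊆ A then 1 else 0 := by
  split_ifs with h
  · refine Finset.prod_eq_one fun i hi => ?_
    rw [boolPoint, if_pos (h hi), one_pow]
  · obtain ⟨i, hi, hiA⟩ := Finset.not_subset.1 h
    refine Finset.prod_eq_zero hi ?_
    rw [boolPoint, if_neg hiA, zero_pow (Finsupp.mem_support_iff.1 hi)]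

theorem eval_boolPoint (A : Finset (Fin n)) (f : MvPolynomial (Fin n) (ZMod m)) :
    MvPolynomial.eval (boolPoint m A) f =
      ∑ t ∈ f.support, f.coeff t * if t.support ⊆ A then 1 else 0 := by
  rw [MvPolynomial.eval_eq]
  simp only [prod_boolPoint]

theorem sqfreeExp_apply (I : Finset (Fin n)) (j : Fin n) :
    sqfreeExp I j = if j ∈ I then 1 else 0 := by
  rw [sqfreeExp, Finsupp.finsetSum_apply]
  simp [Finsupp.single_apply]

theorem support_sqfreeExp (I : Finset (Fin n)) : (sqfreeExp I).support = I := by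
  ext j; simp [sqfreeExp_apply]

theorem sqfreeExp_injective : Function.Injective (sqfreeExp (n := n)) := fun I I' h => by
  rw [← support_sqfreeExp I, h, support_sqfreeExp]

theorem eval_multilinearization (A : Finset (Fin n)) (f : MvPolynomial (Fin n) (ZMod m)) :
    MvPolynomial.eval (boolPoint m A) (multilinearization f) =
      MvPolynomial.eval (boolPoint m A) f := by
  rw [eval_boolPoint A f, multilinearization, map_sum]
  refine Finset.sum_congr rfl fun t _ => ?_
  rw [MvPolynomial.eval_monomial, Finsupp.prod, prod_boolPoint, support_sqfreeExp]

theorem support_multilinearization_subset (f : MvPolynomial (Fin n) (ZMod m)) :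
    (multilinearization f).support ⊆ f.support.image fun t => sqfreeExp t.support := by
  classical
  refine MvPolynomial.support_sum.trans ?_
  intro u hu
  obtain ⟨t, ht, hu⟩ := Finset.mem_biUnion.1 hu
  have := MvPolynomial.support_monomial_subset hu
  exact Finset.mem_image.2 ⟨t, ht, (Finset.mem_singleton.1 this).symm⟩

theorem card_monomialCopies_le (f : MvPolynomial (Fin n) (ZMod m)) :
    (monomialCopies (multilinearization f)).card ≤ m * f.support.card := by
  classical
  have : monomialCopies (multilinearization f) ⊆
      Finset.Icc 1 m ×ˢ f.support.image fun t => t.support := by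
    intro q hq
    simp only [monomialCopies, Finset.mem_filter, Finset.mem_product, Finset.mem_univ,
      and_true] at hq
    refine Finset.mem_product.2 ⟨hq.1, ?_⟩
    have hne : (multilinearization f).coeff (sqfreeExp q.2) ≠ 0 := by
      intro h
      have := (Finset.mem_Icc.1 hq.1).1
      rw [h, ZMod.val_zero] at hq
      omega
    obtain ⟨t, ht, h⟩ := Finset.mem_image.1
      (support_multilinearization_subset f (MvPolynomial.mem_support_iff.2 hne))
    exact Finset.mem_image.2 ⟨t, ht, sqfreeExp_injective h⟩
  refine (Finset.card_le_card this).trans ?_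
  rw [Finset.card_product, Nat.card_Icc, Nat.add_sub_cancel]
  exact Nat.mul_le_mul_left _ Finset.card_image_le

/-- At the characteristic function of `A` a monomial is 1 or 0 according to whether its variables
lie in `A`, and a coefficient is modulo `m` the number of its copies. Passing to the
multilinearization does not change values at such points. -/
theorem sum_monomialCopies [NeZero m] (A : Finset (Fin n)) (f : MvPolynomial (Fin n) (ZMod m)) :
    ∑ q ∈ monomialCopies (multilinearization f), (if q.2 ⊆ A then (1 : ZMod m) else 0) =
      MvPolynomial.eval (boolPoint m A) f := by
  classical
  rw [← eval_multilinearization, eval_boolPoint]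
  set g := multilinearization f with hg
  have h1 : ∑ t ∈ g.support, (g.coeff t * if t.support ⊆ A then (1 : ZMod m) else 0) =
      ∑ t ∈ (Finset.univ : Finset (Finset (Fin n))).image sqfreeExp,
        (g.coeff t * if t.support ⊆ A then (1 : ZMod m) else 0) := by
    refine Finset.sum_subset ?_ fun t _ ht => ?_
    · refine (support_multilinearization_subset f).trans fun t ht => ?_
      obtain ⟨u, _, rfl⟩ := Finset.mem_image.1 ht
      simp
    · rw [MvPolynomial.notMem_support_iff.1 ht, zero_mul]
  rw [h1, Finset.sum_image fun I _ I' _ h => sqfreeExp_injective h, monomialCopies,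
    Finset.sum_filter, Finset.sum_product_right]
  refine Finset.sum_congr rfl fun I _ => ?_
  simp only [support_sqfreeExp]
  by_cases hI : I ⊆ A
  · simp only [hI, if_true, mul_one]
    rw [← Finset.sum_filter, Finset.sum_const, nsmul_eq_mul, mul_one]
    have : ((Finset.Icc 1 m).filter fun c => c ≤ (g.coeff (sqfreeExp I)).val) =
        Finset.Icc 1 (g.coeff (sqfreeExp I)).val := by
      have := ZMod.val_lt (g.coeff (sqfreeExp I))
      ext c; simp only [Finset.mem_filter, Finset.mem_Icc]; omega
    rw [this, Nat.card_Icc, Nat.add_sub_cancel, ZMod.natCast_zmod_val]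
  · simp [hI]

variable {k : ℕ}

theorem eval_refutation {f p : Fin k → MvPolynomial (Fin n) (ZMod m)}
    {r : Fin n → MvPolynomial (Fin n) (ZMod m)} (h : IsNullstellensatzRefutation f p r)
    (A : Finset (Fin n)) :
    ∑ i, MvPolynomial.eval (boolPoint m A) (p i) * MvPolynomial.eval (boolPoint m A) (f i) = 1 := by
  have := congrArg (MvPolynomial.eval (boolPoint m A)) h
  simp only [map_add, map_sum, map_mul, map_sub, map_pow, MvPolynomial.eval_X, map_one] at this
  rwa [Finset.sum_eq_zero (s := (Finset.univ : Finset (Fin n))), add_zero] at this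
  intro j _
  rw [boolPoint]; split_ifs <;> simp

/-- The indices of the copies of the monomials of the `p i` in the variables `W`. -/
noncomputable def blocks (p : Fin k → MvPolynomial (Fin n) (ZMod m)) (W : Finset (Fin n)) :
    Finset (Σ _ : Fin k, Σ _ : Fin n →₀ ℕ, ℕ) :=
  Finset.univ.sigma fun i => ((p i).support.filter fun t => t.support ⊆ W).sigma fun t =>
    Finset.range ((p i).coeff t).val

/-- Monomials with a variable outside `W` vanish at `A ⊆ W`, so `blocks` may omit them without
changing the value of `p i`. -/
theorem sum_blocks [NeZero m] (p : Fin k → MvPolynomial (Fin n) (ZMod m)) {A W : Finset (Fin n)}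
    (hA : A ⊆ W) (g : Fin k → ZMod m) :
    ∑ b ∈ blocks p W, (if b.2.1.support ⊆ A then g b.1 else 0) =
      ∑ i, MvPolynomial.eval (boolPoint m A) (p i) * g i := by
  rw [blocks, Finset.sum_sigma]
  refine Finset.sum_congr rfl fun i _ => ?_
  rw [Finset.sum_sigma, eval_boolPoint, Finset.sum_filter, Finset.sum_mul]
  refine Finset.sum_congr rfl fun t _ => ?_
  by_cases h : t.support ⊆ A
  · simp [h, h.trans hA]
  · simp [h]

theorem card_blocks_le [NeZero m] (p : Fin k → MvPolynomial (Fin n) (ZMod m)) (W : Finset (Fin n)) :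
    (blocks p W).card ≤ m * ∑ i, (p i).support.card := by
  rw [blocks, Finset.card_sigma, Finset.mul_sum]
  refine Finset.sum_le_sum fun i _ => ?_
  rw [Finset.card_sigma]
  refine (Finset.sum_le_card_nsmul _ _ m fun t _ => ?_).trans ?_
  · rw [Finset.card_range]; exact (ZMod.val_lt _).le
  · rw [smul_eq_mul, mul_comm]; exact Nat.mul_le_mul_left _ (Finset.card_filter_le _ _)

end Polynomials

/-- Erasing `v` embeds the edges at `v` into the `(m - 1)`-subsets. -/
theorem card_edgesAt_le {α : Type} (m : ℕ) (S : Finset α) (v : α) :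
    (edgesAt m S v).card ≤ S.card ^ (m - 1) := by
  classical
  refine le_trans ?_ (Nat.choose_le_pow S.card (m - 1))
  rw [← Finset.card_powersetCard]
  refine Finset.card_le_card_of_injOn (fun e => e.erase v) (fun e he => ?_) fun e he e' he' h => ?_
  · obtain ⟨⟨h₁, h₂⟩, h₃⟩ := mem_edgesAt.1 he
    exact Finset.mem_powersetCard.2 ⟨(Finset.erase_subset _ _).trans h₁, by
      rw [Finset.card_erase_of_mem h₃, h₂]⟩
  · rw [← Finset.insert_erase (mem_edgesAt.1 he).2, ← Finset.insert_erase (mem_edgesAt.1 he').2]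
    simp only at h
    rw [h]

-- Variables of formulas and conjunctions of variables

namespace PForm

variable {V : Type} [DecidableEq V]

mutual
/-- The variables of a formula. -/
def vars : PForm V → Finset V
  | var x => {x}
  | neg A => vars A
  | or l => varsList l
/-- The variables of the members of a list. -/
def varsList : List (PForm V) → Finset V
  | [] => ∅
  | A :: l => vars A ∪ varsList l
end

theorem mem_varsList {x : V} {l : List (PForm V)} : x ∈ varsList l ↔ ∃ A ∈ l, x ∈ vars A := by
  induction l with
  | nil => simp [varsList]
  | cons A l ih => simp [varsList, ih]

theorem card_vars_le (A : PForm V) : (vars A).card ≤ size A := by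
  induction A using induction_on with
  | hvar x => simp [vars, size]
  | hneg A ih => simp only [vars, size]; omega
  | hor l ih =>
    suffices (varsList l).card ≤ sizeList l by simp only [vars, size]; omega
    induction l with
    | nil => simp [varsList]
    | cons A l ihl =>
      have ihl := ihl fun B hB => ih B (List.mem_cons_of_mem _ hB)
      rw [varsList, sizeList]
      split_ifs with h
      · rw [zero_add, Finset.union_eq_right.2 fun x hx => mem_varsList.2 ⟨A, h, hx⟩]
        exact ihl
      · exact (Finset.card_union_le _ _).trans (Nat.add_le_add (ih A List.mem_cons_self) ihl)

theorem card_varsList_le (L : List (PForm V)) : (varsList L).card ≤ derivationSize L := by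
  induction L with
  | nil => simp [varsList]
  | cons A L ih =>
    rw [varsList, derivationSize, List.map_cons, List.sum_cons]
    exact (Finset.card_union_le _ _).trans (Nat.add_le_add (card_vars_le A) ih)

theorem vars_subset_conj {A : PForm V} {l : List (PForm V)} (h : A ∈ l) :
    vars A ⊆ vars (conj l) := fun x hx => by
  rw [conj, vars, vars, mem_varsList]
  exact ⟨neg A, List.mem_map_of_mem h, by rwa [vars]⟩

theorem vars_subset_bigAnd {α : Type} {S : Finset α} {a : α} (φ : α → PForm V) (h : a ∈ S) :
    vars (φ a) ⊆ vars (bigAnd S φ) :=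
  vars_subset_conj (List.mem_map_of_mem (Finset.mem_toList.2 h))

end PForm

theorem PForm.Within.of_mem_conj {V : Type} {s δ : ℕ} {A : PForm V} {l : List (PForm V)}
    (hA : A ∈ l) (h : Within s δ (conj l)) : Within s δ A :=
  (h.of_neg.of_mem (List.mem_map_of_mem hA)).of_neg

theorem PForm.Within.of_mem_bigAnd {V α : Type} {s δ : ℕ} {S : Finset α} {φ : α → PForm V} {a : α}
    (ha : a ∈ S) (h : Within s δ (bigAnd S φ)) : Within s δ (φ a) :=
  h.of_mem_conj (List.mem_map_of_mem (Finset.mem_toList.2 ha))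

theorem satisfied_within {n s : ℕ} {I : Finset (Fin n)} (h : 2 * I.card + 2 ≤ s) :
    Within s 3 (satisfied I) := by
  have : Within (1 + I.card * 2) 2 (or ((I.toList.map var).map neg)) := by
    refine (Within.or_of_forall (s := 2) (δ := 1) ?_).mono (by simp) le_rfl
    intro A hA
    simp only [List.map_map, List.mem_map] at hA
    obtain ⟨j, _, rfl⟩ := hA
    exact ⟨by simp [size], by simp [depth]⟩
  exact this.neg.mono (by omega) (by omega)

theorem neg_vars_mem {n : ℕ} {I : Finset (Fin n)} {A : PForm (Fin n)} :
    A ∈ (I.toList.map var).map neg ↔ ∃ j ∈ I, neg (var j) = A := by simp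

/-- The conditions `x_J ∧ x_I ↔ x_{J ∪ I}`. -/
theorem satisfied_union : ∃ c : ℕ, ∀ {n : ℕ} {Ax K : Set (PForm (Fin n))} {D s δ : ℕ}
    {I J : Finset (Fin n)}, δ + c ≤ D → Within s δ (satisfied (J ∪ I)) →
    Proves Ax D K (c * (s + 1)) {or [neg (satisfied (J ∪ I)), satisfied J]} ∧
    Proves Ax D K (c * (s + 1)) {or [neg (satisfied (J ∪ I)), satisfied I]} ∧
    Proves Ax D K (c * (s + 1))
      {or [neg (satisfied J), or [neg (satisfied I), satisfied (J ∪ I)]]} := by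
  obtain ⟨c₁, h₁⟩ := Proves.taut (k := 2) [or [neg (var 0), var 1]]
    (or [neg (neg (var 1)), neg (var 0)]) (by intro v; simp [eval, evalList]; tauto)
  obtain ⟨c₂, h₂⟩ := Proves.taut (k := 3) [or [or [neg (var 0), var 1], var 2]]
    (or [neg (neg (var 1)), or [neg (neg (var 2)), neg (var 0)]])
    (by intro v; simp [eval, evalList]; tauto)
  refine ⟨c₁ + c₂ + 40, fun {n Ax K D s δ I J} hD h => ?_⟩
  -- `satisfied I` is the negation of a disjunction of negated variables. All three facts thus
  -- reduce to inclusions and unions of disjunctions, at linear cost.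
  have hW : Within s δ (or (((J ∪ I).toList.map var).map neg)) := h.of_neg
  have sub : ∀ I', I' ⊆ J ∪ I → (I'.toList.map (var (V := Fin n))).map neg ⊆
      ((J ∪ I).toList.map var).map neg := fun I' hI' A hA => by
    obtain ⟨j, hj, rfl⟩ := neg_vars_mem.1 hA
    exact neg_vars_mem.2 ⟨j, hI' hj, rfl⟩
  have key : ∀ I', I' ⊆ J ∪ I → Proves Ax D K ((c₁ + c₂ + 40) * (s + 1))
      {or [neg (satisfied (J ∪ I)), satisfied I']} := fun I' hI' =>
    (h₁ (δ := δ) ![or ((I'.toList.map var).map neg), _] (by omega)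
      (.forall₂ (hW.of_subset (sub I' hI')) hW)
      (.cons (.imp_of_subset (sub I' hI') hW (by omega)) .nil)).cost
        (Nat.mul_le_mul_right _ (by simp; omega))
  refine ⟨key J Finset.subset_union_left, key I Finset.subset_union_right, ?_⟩
  exact (h₂ (δ := δ) ![_, or ((J.toList.map var).map neg), or ((I.toList.map var).map neg)]
    (by omega) (.forall₃ hW (hW.of_subset (sub J Finset.subset_union_left))
      (hW.of_subset (sub I Finset.subset_union_right)))
    (.cons (.split (fun A => by simp only [neg_vars_mem, Finset.mem_union, or_and_right, exists_or])
      hW (by omega)) .nil)).cost (Nat.mul_le_mul_right _ (by simp; omega))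

theorem satisfied_empty : ∃ c : ℕ, ∀ {n : ℕ} {Ax K : Set (PForm (Fin n))} {D s : ℕ},
    c ≤ D → Proves Ax D K (c * (s + 1)) {satisfied ∅} := by
  obtain ⟨c, hc⟩ := Proves.taut (k := 0) [] (neg (or [])) (by intro v; simp [eval, evalList])
  refine ⟨c, fun {n Ax K D s} hD => ?_⟩
  have := hc (Ax := Ax) (K := K) (D := D) (s := s) (δ := 0) (ns := []) (V := Fin n) ![] (by omega)
    (fun i => i.elim0) .nil
  have hsat : satisfied (∅ : Finset (Fin n)) = neg (or []) := by simp [satisfied, bigAnd, conj]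
  rw [hsat]
  exact this.cost (by simp)

-- Reading off the conditions of an `m`-partition

section Partition

variable {n m : ℕ} {f : MvPolynomial (Fin n) (ZMod m)}
  {θ : Finset (ℕ × Finset (Fin n)) → PForm (Fin n)}

/-- The conditions on an `m`-partition can be extracted from the partition formula. -/
theorem partition_facts : ∃ c : ℕ, ∀ {n m : ℕ} {f : MvPolynomial (Fin n) (ZMod m)}
    {θ : Finset (ℕ × Finset (Fin n)) → PForm (Fin n)} {Ax K : Set (PForm (Fin n))} {D s δ : ℕ}
    {q : ℕ × Finset (Fin n)}, δ + c ≤ D → Within s δ (partitionFormula f θ) →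
    partitionFormula f θ ∈ K → q ∈ monomialCopies f →
    (∀ E ∈ edgesAt m (monomialCopies f) q,
      Proves Ax D K (c * (s + 1)) {or [neg (θ E), satisfied q.2]}) ∧
    (∀ E ∈ edgesAt m (monomialCopies f) q, ∀ F ∈ edgesAt m (monomialCopies f) q, E ≠ F →
      Proves Ax D K (c * (s + 1)) {or [neg (θ E), neg (θ F)]}) ∧
    Proves Ax D K (c * (s + 1))
      {or [neg (satisfied q.2), bigOr (edgesAt m (monomialCopies f) q) θ]} := by
  obtain ⟨c₁, conj_elim⟩ := Proves.conj_elim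
  obtain ⟨c₂, imp_mem⟩ := Proves.imp_mem
  obtain ⟨c₃, h₃⟩ := Proves.taut (k := 3)
    [or [neg (var 0), neg (var 1)], or [neg (neg (var 2)), var 1]] (or [neg (var 0), var 2])
    (by intro v; simp [eval, evalList]; tauto)
  refine ⟨2 * c₁ + c₂ + c₃, fun {n m f θ Ax K D s δ q} hD hW hK hq => ?_⟩
  have elim : ∀ {α : Type} (S : Finset α) (φ : α → PForm (Fin n)) (a : α), a ∈ S →
      Within s δ (bigAnd S φ) → Proves Ax D K ((0 + c₁) * (s + 1)) {bigAnd S φ} →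
      Proves Ax D K ((0 + c₁ + c₁) * (s + 1)) {φ a} := fun S φ a ha hS h =>
    conj_elim (l := S.toList.map φ) (List.mem_map_of_mem (Finset.mem_toList.2 ha)) hS (by omega) h
  have top : ∀ {A}, A ∈ _ → Proves Ax D K ((0 + c₁) * (s + 1)) {A} := fun {A} hA =>
    conj_elim hA hW (by omega) (.of_mem hK)
  refine ⟨fun E hE => ?_, fun E hE F hF hEF => ?_, ?_⟩
  · obtain ⟨⟨h₁, h₂⟩, hqE⟩ := mem_edgesAt.1 hE
    have hE' := Finset.mem_powersetCard.2 ⟨h₁, h₂⟩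
    have hWt := hW.of_mem_conj (List.mem_cons_self ..)
    have hWE := hWt.of_mem_bigAnd hE'
    have e₁ := elim _ _ E hE' hWt (top (List.mem_cons_self ..))
    have hWθ : Within s δ (θ E) := (hWE.of_mem (A := neg (θ E)) (by simp)).of_neg
    have hWb : Within s δ (bigAnd E fun q => satisfied q.2) :=
      hWE.of_mem (A := bigAnd E fun q => satisfied q.2) (by simp)
    have hmem : neg (satisfied q.2) ∈ (E.toList.map fun q => satisfied q.2).map neg :=
      List.mem_map_of_mem (List.mem_map.2 ⟨q, Finset.mem_toList.2 hqE, rfl⟩)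
    exact (h₃ (δ := δ) ![θ E, _, satisfied q.2] (by omega)
      (.forall₃ hWθ hWb.of_neg (hWb.of_mem_bigAnd (φ := fun q => satisfied q.2) hqE))
      (.cons e₁ (.cons (imp_mem hmem hWb.of_neg (by omega)) .nil))).cost
        (Nat.mul_le_mul_right _ (by simp; omega))
  · obtain ⟨⟨h₁, h₂⟩, hqE⟩ := mem_edgesAt.1 hE
    obtain ⟨⟨h₃, h₄⟩, hqF⟩ := mem_edgesAt.1 hF
    have hEF' : (E, F) ∈ conflictPairs m (monomialCopies f) := mem_conflictPairs.2
      ⟨⟨h₁, h₂⟩, ⟨h₃, h₄⟩, hEF, Finset.not_disjoint_iff.2 ⟨q, hqE, hqF⟩⟩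
    exact (elim _ _ (E, F) hEF' (hW.of_mem_conj (.tail _ (.head _))) (top (.tail _ (.head _)))).cost
      (Nat.mul_le_mul_right _ (by omega))
  · exact (elim _ _ q hq (hW.of_mem_conj (.tail _ (.tail _ (.head _))))
      (top (.tail _ (.tail _ (.head _))))).cost
      (Nat.mul_le_mul_right _ (by omega))

theorem within_bigOr_edgesAt {s δ : ℕ} {q : ℕ × Finset (Fin n)}
    (hW : Within s δ (partitionFormula f θ)) (hq : q ∈ monomialCopies f) :
    Within s δ (bigOr (edgesAt m (monomialCopies f) q) θ) :=
  ((hW.of_mem_conj (A := bigAnd (monomialCopies f) fun q =>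
    imp (satisfied q.2) (bigOr (edgesAt m (monomialCopies f) q) θ)) (by simp)).of_mem_bigAnd
      hq).of_mem (by simp)

/-- This places the variables of the `f i` among those of the given derivation, whose number is at
most `T`. -/
theorem subset_vars_partitionFormula {q : ℕ × Finset (Fin n)} (hq : q ∈ monomialCopies f) :
    q.2 ⊆ vars (partitionFormula f θ) := by
  intro j hj
  have h1 : vars (bigAnd (monomialCopies f) fun q =>
      imp (satisfied q.2) (bigOr (edgesAt m (monomialCopies f) q) θ)) ⊆
        vars (partitionFormula f θ) := vars_subset_conj (by simp)
  refine h1 (vars_subset_bigAnd _ hq ?_)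
  simp only [imp, vars, varsList, Finset.mem_union]
  left
  exact vars_subset_bigAnd (S := q.2) var hj (by simp [vars])

end Partition

-- Assembling a refutation and bounding its size

theorem exists_refutation {V : Type} {Ax H : Set (PForm V)} {D n : ℕ} {L : List (PForm V)}
    (hL : IsDerivation Ax H L) (hD : DerivationDepthLE L D)
    (h : Proves Ax D {A | A ∈ L} n {fls}) :
    ∃ L', IsRefutation Ax H L' ∧ DerivationDepthLE L' D ∧
      derivationSize L' ≤ derivationSize L + n := by
  obtain ⟨L₁, h₁, h₂, h₃, h₄⟩ := h
  have hder := h₁.isDerivation_append hL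
  have hmem : fls ∈ L ++ L₁.reverse := by simpa using h₄ fls rfl
  obtain ⟨i, hi, hi'⟩ := List.getElem_of_mem hmem
  -- FALSE has to be the final formula, so the derivation is cut off right after an occurrence of
  -- it.
  refine ⟨(L ++ L₁.reverse).take (i + 1), ⟨fun j hj => ?_, ?_⟩, fun A hA => ?_, ?_⟩
  · rw [List.length_take] at hj
    rw [List.getElem_take, List.take_take, min_eq_left (by omega)]
    exact hder j (by omega)
  · rw [List.take_succ_eq_append_getElem hi, List.getLast?_append]
    simp [hi']
  · have := List.mem_of_mem_take hA
    rcases List.mem_append.1 this with hA | hA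
    · exact hD A hA
    · exact h₂ A (List.mem_reverse.1 hA)
  · have : derivationSize ((L ++ L₁.reverse).take (i + 1)) ≤ derivationSize (L ++ L₁.reverse) :=
      (((List.take_sublist _ _).map size).sum_le_sum fun _ _ => Nat.zero_le _)
    refine this.trans ?_
    simp only [derivationSize, List.map_append, List.sum_append, List.map_reverse,
      List.sum_reverse] at *
    omega

/-- Here `N` is the number of vertices and `X` stands for `m * S`. Taking `h` from the rounded-up
binary logarithm of `X` keeps `2 ^ h` of order `X ^ (m + 1)`. Then `h = O(X)` and `h * 2 ^ h = O(X ^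
(m + 2))`, which is within `X ^ (2 * m)` because `m ≥ 2`. The other summand is of order `X ^ (m + 1)
* X ^ (m - 1)`. -/
theorem exists_height_bound (m c e : ℕ) (hm : 1 < m) : ∃ C : ℕ, ∀ N X : ℕ, 0 < X →
    N ≤ (m + 1) * X ^ (m + 1) → ∃ h, c * N ≤ 2 ^ h ∧
      c * N * ((X ^ (m - 1) + 1) * e) + c * (h + 1) * 2 ^ h ≤ C * X ^ (2 * m) := by
  obtain ⟨a, ha⟩ : ∃ a, a = c * (m + 1) := ⟨_, rfl⟩
  refine ⟨a * (2 * e) + c * ((a + m + 2) * (2 ^ a * 2 ^ (m + 1))), fun N X hX hN => ?_⟩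
  have hclog : X ≤ 2 ^ Nat.clog 2 X := Nat.le_pow_clog (by norm_num) X
  have hclog' : 2 ^ Nat.clog 2 X ≤ 2 * X := by
    obtain rfl | h := (Nat.succ_le_of_lt hX).eq_or_lt
    · simp
    · have h1 := Nat.pow_pred_clog_lt_self (b := 2) (by norm_num) h
      have h2 : 0 < Nat.clog 2 X := Nat.clog_pos (by norm_num) h
      obtain ⟨l, hl⟩ : ∃ l, Nat.clog 2 X = l + 1 := ⟨_, (Nat.succ_pred_eq_of_pos h2).symm⟩
      rw [hl] at h1 ⊢
      rw [Nat.pred_succ] at h1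
      rw [pow_succ]; omega
  have hclogX : Nat.clog 2 X ≤ X := Nat.clog_le_of_le_pow Nat.lt_two_pow_self.le
  have hcN : c * N ≤ a * X ^ (m + 1) := by
    rw [ha, mul_assoc]; exact Nat.mul_le_mul_left _ hN
  refine ⟨a + (m + 1) * Nat.clog 2 X, ?_, ?_⟩
  · refine hcN.trans ?_
    rw [pow_add 2, mul_comm (m + 1) (Nat.clog 2 X), pow_mul 2]
    exact Nat.mul_le_mul Nat.lt_two_pow_self.le (Nat.pow_le_pow_left hclog _)
  · have h1 : X ^ (m - 1) + 1 ≤ 2 * X ^ (m - 1) := by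
      have := Nat.one_le_pow (m - 1) X hX
      omega
    have h2 : X ^ (m + 1) * X ^ (m - 1) = X ^ (2 * m) := by
      rw [← pow_add]; congr 1; omega
    have h3 : 2 ^ (a + (m + 1) * Nat.clog 2 X) ≤ 2 ^ a * 2 ^ (m + 1) * X ^ (m + 1) := by
      rw [pow_add, mul_comm (m + 1), pow_mul, mul_assoc, ← mul_pow]
      exact Nat.mul_le_mul_left _ (Nat.pow_le_pow_left hclog' _)
    have h4 : a + (m + 1) * Nat.clog 2 X + 1 ≤ (a + m + 2) * X := by
      have := Nat.mul_le_mul_left (m + 1) hclogX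
      nlinarith
    have h5 : X * X ^ (m + 1) ≤ X ^ (2 * m) := by
      rw [← pow_succ']
      exact Nat.pow_le_pow_right hX (by omega)
    calc _ ≤ a * X ^ (m + 1) * (2 * X ^ (m - 1) * e) +
          c * ((a + m + 2) * X) * (2 ^ a * 2 ^ (m + 1) * X ^ (m + 1)) := by gcongr
      _ = a * (2 * e) * (X ^ (m + 1) * X ^ (m - 1)) +
          c * ((a + m + 2) * (2 ^ a * 2 ^ (m + 1))) * (X * X ^ (m + 1)) := by ring
      _ ≤ a * (2 * e) * X ^ (2 * m) +
          c * ((a + m + 2) * (2 ^ a * 2 ^ (m + 1))) * X ^ (2 * m) := by rw [h2]; gcongr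
      _ = _ := by ring

theorem mem_blocks_subset {n m k : ℕ} {p : Fin k → MvPolynomial (Fin n) (ZMod m)}
    {W : Finset (Fin n)} {b : Σ _ : Fin k, Σ _ : Fin n →₀ ℕ, ℕ} (hb : b ∈ blocks p W) :
    b.2.1.support ⊆ W := by
  simp only [blocks, Finset.mem_sigma, Finset.mem_filter] at hb
  exact hb.2.1.2

/-- The chain gadget of a Nullstellensatz refutation: its points are the monomials in the expansion
of the polynomials `p i * f i`. -/
noncomputable def nullstellensatzGadget {n m k : ℕ} (f p : Fin k → MvPolynomial (Fin n) (ZMod m))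
    (β : Fin k → Finset (ℕ × Finset (Fin n)) → PForm (Fin n)) (W : Finset (Fin n))
    (grp : (Σ _ : Fin k, Σ _ : Fin n →₀ ℕ, ℕ) × (ℕ × Finset (Fin n)) →
      Finset ((Σ _ : Fin k, Σ _ : Fin n →₀ ℕ, ℕ) × (ℕ × Finset (Fin n)))) :
    ChainGadget (Fin n) (Σ _ : Fin k, Σ _ : Fin n →₀ ℕ, ℕ) (ℕ × Finset (Fin n)) where
  m := m
  B := blocks p W
  M b := monomialCopies (multilinearization (f b.1))
  θ b := β b.1
  J b := satisfied b.2.1.support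
  Q z := satisfied (z.1.2.1.support ∪ z.2.2)
  triv z := z.1.2.1.support ∪ z.2.2 = ∅
  grp := grp

-- Counting the points and vertices of a Nullstellensatz refutation

section Gadget

variable {n m k : ℕ} {f p : Fin k → MvPolynomial (Fin n) (ZMod m)}
  {β : Fin k → Finset (ℕ × Finset (Fin n)) → PForm (Fin n)} {W : Finset (Fin n)}
  {grp : (Σ _ : Fin k, Σ _ : Fin n →₀ ℕ, ℕ) × (ℕ × Finset (Fin n)) →
    Finset ((Σ _ : Fin k, Σ _ : Fin n →₀ ℕ, ℕ) × (ℕ × Finset (Fin n)))}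

/-- Expanding `∑ p i * f i` at the characteristic function of `A`, a point contributes 1 if both its
monomials lie in `A`, that is, if their union does, and 0 otherwise. -/
theorem card_points_below [NeZero m] {r : Fin n → MvPolynomial (Fin n) (ZMod m)}
    (h : IsNullstellensatzRefutation f p r) {A : Finset (Fin n)} (hA : A ⊆ W) :
    (((nullstellensatzGadget f p β W grp).points.filter
      fun z => z.1.2.1.support ∪ z.2.2 ⊆ A).card : ZMod m) = 1 := by
  rw [← eval_refutation h A, ← sum_blocks p hA, Finset.card_filter, Nat.cast_sum,
    Finset.sum_finset_product _ (blocks p W)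
      (fun b => monomialCopies (multilinearization (f b.1))) fun z => ChainGadget.mem_points]
  refine Finset.sum_congr rfl fun b _ => ?_
  split_ifs with hb
  · rw [← sum_monomialCopies]
    refine Finset.sum_congr rfl fun q _ => ?_
    simp [Finset.union_subset_iff, hb]
  · refine Finset.sum_eq_zero fun q _ => ?_
    simp [Finset.union_subset_iff, hb]

/-- Points are grouped by their monomial `x_{J ∪ I}`, which makes `Q` constant on groups. Only the
fibre of the empty monomial has size 1 modulo `m`, and its points are exactly the trivial ones.
Fibres of monomials not inside `W` are empty. -/
theorem exists_isGrouped [NeZero m] {r : Fin n → MvPolynomial (Fin n) (ZMod m)}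
    (h : IsNullstellensatzRefutation f p r)
    (hW : ∀ i, ∀ q ∈ monomialCopies (multilinearization (f i)), q.2 ⊆ W) :
    ∃ grp, (nullstellensatzGadget f p β W grp).IsGrouped := by
  classical
  let G₀ := nullstellensatzGadget f p β W fun _ => ∅
  obtain ⟨grp, hgrp⟩ := exists_groups (NeZero.pos m)
    (fun z : (Σ _ : Fin k, Σ _ : Fin n →₀ ℕ, ℕ) × (ℕ × Finset (Fin n)) =>
      z.1.2.1.support ∪ z.2.2) (G₀.points.filter fun z => ¬ G₀.triv z) fun A => by
    rw [Finset.filter_filter]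
    by_cases hA : A = ∅
    · have : (G₀.points.filter fun z => ¬ G₀.triv z ∧ z.1.2.1.support ∪ z.2.2 = A) = ∅ :=
        Finset.filter_false_of_mem fun z _ h => h.1 (h.2.trans hA)
      rw [this]; simp
    have : (G₀.points.filter fun z => ¬ G₀.triv z ∧ z.1.2.1.support ∪ z.2.2 = A) =
        G₀.points.filter fun z => z.1.2.1.support ∪ z.2.2 = A :=
      Finset.filter_congr fun z _ => ⟨fun h => h.2, fun h => ⟨fun h' => hA (h.symm.trans h'), h⟩⟩
    rw [this]
    by_cases hAW : A ⊆ W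
    · rw [← ZMod.natCast_eq_zero_iff]
      exact card_fiber_eq_zero _ G₀.points W (fun A hA => card_points_below h hA) A hAW hA
    · rw [Finset.filter_false_of_mem]
      · simp
      · rintro z hz rfl
        obtain ⟨h₁, h₂⟩ := ChainGadget.mem_points.1 hz
        exact hAW (Finset.union_subset (mem_blocks_subset h₁) (hW _ _ h₂))
  have key : ∀ z ∈ G₀.points, ¬ G₀.triv z → _ := fun z hz ht =>
    hgrp z (Finset.mem_filter.2 ⟨hz, ht⟩)
  refine ⟨grp, fun z hz ht => (key z hz ht).1,
    fun z hz ht => (key z hz ht).2.1.trans (Finset.filter_subset _ _),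
    fun z hz ht => (key z hz ht).2.2.1, fun z hz ht w hw => ?_⟩
  obtain ⟨_, h₁, _, h₂⟩ := key z hz ht
  exact ⟨(h₂ w hw).1, (Finset.mem_filter.1 (h₁ hw)).2, congrArg satisfied (h₂ w hw).2⟩

/-- A chain has `len * m + 1` vertices, so modulo `m` there are as many vertices as points. All
points have their monomial inside `W`, so this number is 1. -/
theorem not_dvd_card_vertices (hm : 1 < m) {r : Fin n → MvPolynomial (Fin n) (ZMod m)}
    (h : IsNullstellensatzRefutation f p r)
    (hW : ∀ i, ∀ q ∈ monomialCopies (multilinearization (f i)), q.2 ⊆ W) :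
    ¬ m ∣ (nullstellensatzGadget f p β W grp).vertices.card := by
  have : NeZero m := ⟨by omega⟩
  have : Fact (1 < m) := ⟨hm⟩
  have h1 := card_points_below (β := β) (grp := grp) h (subset_refl W)
  rw [Finset.filter_true_of_mem] at h1
  · rw [← ZMod.natCast_eq_zero_iff, ChainGadget.card_vertices, Finset.sum_add_distrib,
      ← Finset.sum_mul, Finset.sum_const, smul_eq_mul, mul_one, Nat.cast_add, h1, Nat.cast_mul]
    simp [nullstellensatzGadget]
  · intro z hz
    obtain ⟨h₁, h₂⟩ := ChainGadget.mem_points.1 hz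
    exact Finset.union_subset (mem_blocks_subset h₁) (hW _ _ h₂)

theorem len_le {S : ℕ} (hS : ∀ i, m * (f i).support.card ≤ S)
    (z : (Σ _ : Fin k, Σ _ : Fin n →₀ ℕ, ℕ) × (ℕ × Finset (Fin n))) :
    (nullstellensatzGadget f p β W grp).len z ≤ S ^ (m - 1) := by
  refine (Finset.length_toList _).le.trans ((card_edgesAt_le _ _ _).trans ?_)
  exact Nat.pow_le_pow_left ((card_monomialCopies_le _).trans (hS _)) _

/-- At most `S` blocks with at most `S` monomial copies each, and at most `m * S ^ (m - 1) + 1`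
vertices at a point. -/
theorem card_vertices_le [NeZero m] {S : ℕ} (hS : ∀ i, m * (f i).support.card ≤ S)
    (hS' : m * ∑ i, (p i).support.card ≤ S) (hS0 : 0 < S) :
    (nullstellensatzGadget f p β W grp).vertices.card ≤ (m + 1) * S ^ (m + 1) := by
  have h1 : (nullstellensatzGadget f p β W grp).points.card ≤ S * S := by
    rw [Finset.card_eq_sum_ones, Finset.sum_finset_product _ (blocks p W)
      (fun b => monomialCopies (multilinearization (f b.1))) fun z => ChainGadget.mem_points]
    refine (Finset.sum_le_card_nsmul _ _ S fun b _ => ?_).trans ?_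
    · rw [← Finset.card_eq_sum_ones]
      exact (card_monomialCopies_le _).trans (hS _)
    · rw [smul_eq_mul]
      exact Nat.mul_le_mul_right _ ((card_blocks_le p W).trans hS')
  rw [ChainGadget.card_vertices]
  refine (Finset.sum_le_card_nsmul _ _ (S ^ (m - 1) * (m + 1)) fun z _ => ?_).trans ?_
  · have h2 := Nat.mul_le_mul_right m (len_le (p := p) (β := β) (W := W) (grp := grp) hS z)
    have h3 := Nat.one_le_pow (m - 1) S hS0
    rw [mul_add, mul_one]
    exact Nat.add_le_add h2 h3
  · rw [smul_eq_mul]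
    refine (Nat.mul_le_mul_right _ h1).trans (le_of_eq ?_)
    have : S ^ (m + 1) = S * S * S ^ (m - 1) := by
      rw [← sq, ← pow_add]; congr 1; have := NeZero.pos m; omega
    rw [this]; ring

end Gadget

theorem mainTheorem1 (m : ℕ) (hm : 1 < m) :
    ∃ C : ℕ, ∀ (n k : ℕ) (Γ : PForm (Fin n)) (f : Fin k → MvPolynomial (Fin n) (ZMod m))
      (d T S : ℕ), ReducesTo Γ f d T →
      (∃ (p : Fin k → MvPolynomial (Fin n) (ZMod m)) (r : Fin n → MvPolynomial (Fin n) (ZMod m)),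
        IsNullstellensatzRefutation f p r ∧ nullstellensatzSize f p = S) →
      ∃ L : List (PForm (Fin n)),
        IsRefutation (countingAxioms (Fin n) m) {Γ} L ∧
        DerivationDepthLE L (C * d) ∧
        derivationSize L ≤ C * (S ^ (2 * m) * T) := by
  have : NeZero m := ⟨by omega⟩
  have : Fact (1 < m) := ⟨hm⟩
  obtain ⟨c₁, refute⟩ := ChainGadget.refute m hm
  obtain ⟨c₂, union⟩ := satisfied_union
  obtain ⟨c₃, empty⟩ := satisfied_empty
  obtain ⟨c₄, partition⟩ := partition_facts
  obtain ⟨e, he⟩ : ∃ e, e = c₂ + c₃ + c₄ := ⟨_, rfl⟩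
  obtain ⟨c₅, height⟩ := exists_height_bound m c₁ (e + 1) hm
  -- The first summand is for the size: the height bound is used with `X = m * S`, and `s + 1 = 2 *
  -- T + 3 ≤ 5 * T`. The others cover the additive increase of depth, which becomes a factor since
  -- `d ≥ 1`.
  refine ⟨5 * c₅ * m ^ (2 * m) + c₁ + c₂ + c₃ + c₄ + 10, ?_⟩
  rintro n k Γ f d T S ⟨β, L, hL, hLd, hLT, hβ⟩ ⟨p, r, hpr, rfl⟩
  set S := nullstellensatzSize f p with hSdef
  -- the bounds are positive
  obtain ⟨i₀, hi₀⟩ : ∃ i, MvPolynomial.eval (boolPoint m ∅) (p i) ≠ 0 := by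
    by_contra! h0
    have := eval_refutation hpr ∅
    simp [h0] at this
  have hSp : ∑ i, (p i).support.card ≤ S := by
    rw [hSdef, nullstellensatzSize, Finset.sum_add_distrib]; omega
  have hSf : ∀ i, (f i).support.card ≤ S := fun i => by
    rw [hSdef, nullstellensatzSize, Finset.sum_add_distrib]
    have := Finset.single_le_sum (f := fun i => (f i).support.card) (fun _ _ => Nat.zero_le _)
      (Finset.mem_univ i)
    omega
  have hS : 0 < S := by
    have h1 : p i₀ ≠ 0 := fun h => hi₀ (by rw [h, map_zero])
    have h2 : 0 < (p i₀).support.card := Finset.card_pos.2 (by simpa using h1)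
    have := Finset.single_le_sum (f := fun i => (p i).support.card) (fun _ _ => Nat.zero_le _)
      (Finset.mem_univ i₀)
    omega
  have hsize : ∀ A ∈ L, size A ≤ T := fun A hA =>
    (List.le_sum_of_mem (List.mem_map_of_mem hA)).trans hLT
  have hT : 0 < T := (size_pos _).trans_le (hsize _ (hβ i₀))
  have hd : 0 < d := by
    refine lt_of_lt_of_le ?_ (hLd _ (hβ i₀))
    simp [partitionFormula, conj, depth]
  -- the variables
  let W := varsList L
  have hWT : W.card ≤ T := (card_varsList_le L).trans hLT
  -- `S` counts monomials but not their degrees, so the `p i` may contain long monomials in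
  -- variables foreign to the derivation. Restricting the blocks to the variables `W` discards
  -- these, and every conjunction of variables that is used has size `O(T)`.
  have hW : ∀ i, ∀ q ∈ monomialCopies (multilinearization (f i)), q.2 ⊆ W := fun i q hq =>
    (subset_vars_partitionFormula (θ := β i) hq).trans fun j hj =>
      mem_varsList.2 ⟨_, hβ i, hj⟩
  obtain ⟨grp, hG⟩ := exists_isGrouped (β := β) hpr hW
  set G := nullstellensatzGadget f p β W grp with hGdef
  obtain ⟨h, hh, hcost⟩ := height G.vertices.card (m * S) (by positivity)
    (card_vertices_le (fun i => Nat.mul_le_mul_left _ (hSf i)) (Nat.mul_le_mul_left _ hSp)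
      (by positivity))
  obtain ⟨C, hC⟩ : ∃ C, C = 5 * c₅ * m ^ (2 * m) + c₁ + c₂ + c₃ + c₄ + 10 := ⟨_, rfl⟩
  rw [← hC]
  have hD : d + 3 + (c₁ + c₂ + c₃ + c₄) ≤ C * d := by
    have h1 : d + 3 + (c₁ + c₂ + c₃ + c₄) ≤ (4 + (c₁ + c₂ + c₃ + c₄)) * d := by nlinarith
    exact h1.trans (Nat.mul_le_mul_right _ (by omega))
  have hpart : ∀ i, Within (2 * T + 2) (d + 3) (partitionFormula (multilinearization (f i)) (β i)) :=
    fun i => ⟨(hsize _ (hβ i)).trans (by omega), (hLd _ (hβ i)).trans (by omega)⟩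
  -- A conjunction of at most `T` variables has at most `2 * T + 2` symbols and depth at most 3;
  -- this is the source of both bounds.
  have hsat : ∀ I ⊆ W, Within (2 * T + 2) (d + 3) (satisfied I) := fun I hI =>
    (satisfied_within (by have := Finset.card_le_card hI; omega)).mono le_rfl (by omega)
  have hunion : ∀ z ∈ G.points, z.1.2.1.support ∪ z.2.2 ⊆ W := fun z hz => by
    obtain ⟨h₁, h₂⟩ := ChainGadget.mem_points.1 hz
    exact Finset.union_subset (mem_blocks_subset h₁) (hW _ _ h₂)
  have hcost₂ : c₂ * (2 * T + 2 + 1) ≤ e * (2 * T + 2 + 1) := Nat.mul_le_mul_right _ (by omega)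
  have hcost₄ : c₄ * (2 * T + 2 + 1) ≤ e * (2 * T + 2 + 1) := Nat.mul_le_mul_right _ (by omega)
  have hunion' := fun z hz => union (Ax := countingAxioms (Fin n) m) (K := {A | A ∈ L})
    (D := C * d) (δ := d + 3) (by omega) (hsat _ (hunion z hz))
  have hpartition := fun (z) (hz : z ∈ G.points) =>
    partition (Ax := countingAxioms (Fin n) m) (K := {A | A ∈ L}) (D := C * d) (δ := d + 3)
      (by omega) (hpart z.1.1) (hβ z.1.1) (ChainGadget.mem_points.1 hz).2
  have main := refute G (fun z => satisfied z.2.2) (K := {A | A ∈ L}) (D := C * d) (s := 2 * T + 2)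
    (δ := d + 3) (n := e) (h := h) (R := (m * S) ^ (m - 1)) rfl hG
    (not_dvd_card_vertices hm hpr hW) (by omega) (by omega) (by omega)
    (fun z hz => ⟨within_bigOr_edgesAt (hpart z.1.1) (ChainGadget.mem_points.1 hz).2,
      hsat _ (Finset.union_subset_left (hunion z hz)),
      hsat _ (Finset.union_subset_right (hunion z hz)), hsat _ (hunion z hz)⟩)
    (fun z hz E hE => ((hpartition z hz).1 E (Finset.mem_toList.1 hE)).cost hcost₄)
    (fun z hz E hE F hF hEF => ((hpartition z hz).2.1 E (Finset.mem_toList.1 hE) F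
      (Finset.mem_toList.1 hF) hEF).cost hcost₄)
    (fun z hz => (hpartition z hz).2.2.cost hcost₄)
    (fun z hz => (hunion' z hz).1.cost hcost₂)
    (fun z hz => (hunion' z hz).2.1.cost hcost₂)
    (fun z hz => (hunion' z hz).2.2.cost hcost₂)
    (fun z hz ht => by
      have hQ : G.Q z = satisfied ∅ := congrArg satisfied ht
      rw [hQ]
      exact (empty (by omega)).cost (Nat.mul_le_mul_right _ (by omega)))
    (fun z _ => len_le (fun i => Nat.mul_le_mul_left _ (hSf i)) z) hh
  have hL' : IsDerivation (countingAxioms (Fin n) m) {Γ} L := fun i hi =>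
    (hL i hi).imp id fun h => h.elim (fun h => h.elim) .inr
  obtain ⟨L', h₁, h₂, h₃⟩ := exists_refutation hL'
    (fun A hA => (hLd A hA).trans (Nat.le_mul_of_pos_left _ (by omega))) main
  refine ⟨L', h₁, h₂, h₃.trans ?_⟩
  have hpow : 0 < S ^ (2 * m) := by positivity
  calc _ ≤ T + c₅ * (m * S) ^ (2 * m) * (5 * T) :=
        Nat.add_le_add hLT (Nat.mul_le_mul hcost (by omega))
    _ = T + 5 * c₅ * m ^ (2 * m) * (S ^ (2 * m) * T) := by rw [mul_pow]; ring
    _ ≤ S ^ (2 * m) * T + 5 * c₅ * m ^ (2 * m) * (S ^ (2 * m) * T) :=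
        Nat.add_le_add_right (Nat.le_mul_of_pos_left _ hpow) _
    _ = (5 * c₅ * m ^ (2 * m) + 1) * (S ^ (2 * m) * T) := by ring
    _ ≤ _ := Nat.mul_le_mul_right _ (by omega)
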